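/- **Theorem (Chi-squared test for $\alpha$).** Fix integers $K\ge 0$ and $r\ge 0$ and a noise level $\sigma>0$. For each $n$ (all conditions below are required for all large $n$) let $X\in\mathbb{R}^{n\times p}$, $p=p_n$, be a fixed design matrix of full column rank, let $P,\hat P\in\mathbb{R}^{n\times n}$ be fixed symmetric matrices, and let $W,\hat W\in\mathbb{R}^{n\times K}$ have as columns orthonormal eigenvectors for the $K$ largest eigenvalues (with multiplicity) of $P$ and of $\hat P$. Let $S_K(P)=\mathrm{col}(W)$ and $\mathcal R=\mathrm{col}(X)\cap S_K(P)$, with $\dim\mathcal R=r$. We observe $$Y=X\beta+X\theta+\alpha+\epsilon,\qquad \epsilon\sim N(0,\sigma^2 I_n),$$ where $X\theta\in\mathcal R$, $X\beta\perp\mathcal R$, $\alpha\in S_K(P)$, $\alpha\perp\mathcal R$. Let the columns of $Z\in\mathbb{R}^{n\times p}$ be an orthonormal basis of $\mathrm{col}(X)$, and let $Z^TW=U\Sigma V^T$ and $Z^T\hat W=\hat U\hat\Sigma\hat V^T$ be (full) singular value decompositions with decreasing singular values; those of $Z^TW$ are $1=\sigma_1=\dots=\sigma_r>\sigma_{r+1}\ge\dots\ge\sigma_{r+s}>0=\sigma_{r+s+1}=\cdots$,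 where $s=s_n$. For a matrix $M$ let $M_{i:j}$ be its columns $i,\dots,j$, and put $\hat Z=Z\hat U$, $\breve W=\hat W\hat V$, $\hat M=(\hat Z_{(r+1):p},\breve W_{(r+1):K})$, $$\hat{\mathcal P}_{\mathcal R}=\hat Z_{1:r}\hat Z_{1:r}^T,\quad \hat{\mathcal P}_{\mathcal C}=(\hat Z_{(r+1):p},0)(\hat M^T\hat M)^{-1}\hat M^T,\quad \hat{\mathcal P}_{\mathcal N}=(0,\breve W_{(r+1):K})(\hat M^T\hat M)^{-1}\hat M^T,$$ $$\hat H=\hat{\mathcal P}_{\mathcal R}+\hat{\mathcal P}_{\mathcal C}+\hat{\mathcal P}_{\mathcal N},\qquad \hat\sigma^2=\frac{\|Y-\hat HY\|^2}{n-p-K+r},\qquad \hat\gamma=\breve W_{(r+1):K}^T\hat{\mathcal P}_{\mathcal N}Y\in\mathbb{R}^{K-r},$$ $$\hat\Sigma_{\hat\gamma}=\hat\sigma^2\,\breve W_{(r+1):K}^T\hat{\mathcal P}_{\mathcal N}\hat{\mathcal P}_{\mathcal N}^T\breve W_{(r+1):K},\qquad \hat\gamma_0=\hat\Sigma_{\hat\gamma}^{-1/2}\hat\gamma.$$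 Assume: 1. (standardized scale) every column of $X$ has Euclidean norm $\sqrt n$, and $\|X\beta+X\theta+\alpha\|\le C\sqrt{np}$ for some constant $C>0$; 2. (small projection perturbation) with the spectral norm $\tau_n=\|(\hat W\hat W^T-WW^T)Z\|$, $$\frac{\tau_n}{\min\{(1-\sigma_{r+1})^3,\sigma_{r+s}^3\}}=o\big(1/\sqrt{np}\big),$$ where the minimum is read as $1$ if $s=0$; 3. $p=o(n)$. Then under $H_0:\alpha=0$, as $n\to\infty$, $\|\hat\gamma_0\|^2$ converges in distribution to the chi-squared distribution $\chi^2_{K-r}$ with $K-r$ degrees of freedom ($\chi^2_0$ is the point mass at $0$). In particular the limit is $\chi^2_K$ when $r=0$. -/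

import Mathlib

open Filter MeasureTheory ProbabilityTheory Asymptotics
open scoped Matrix

noncomputable section

namespace NetReg

/-! ### Linear algebra -/

/-- The column space of a matrix with `n` rows. -/
def colSpace {n : ℕ} {ι : Type*} [Fintype ι] (A : Matrix (Fin n) ι ℝ) : Submodule ℝ (Fin n → ℝ) :=
  LinearMap.range A.mulVecLin

/-- The Euclidean norm of a vector given by its coordinates. -/
def euclNorm {ι : Type*} [Fintype ι] (v : ι → ℝ) : ℝ := ‖WithLp.toLp 2 v‖

open scoped Matrix.Norms.L2Operator in
/-- The spectral norm of a real matrix (operator norm for the Euclidean norms). -/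
def specNorm {n k : ℕ} (A : Matrix (Fin n) (Fin k) ℝ) : ℝ := ‖A‖

/-- The columns of `Z` form an orthonormal basis of the column space of `X`
(in particular, `X` has full column rank). -/
structure IsOrthonormalBasisOfCol {n p : ℕ} (X Z : Matrix (Fin n) (Fin p) ℝ) : Prop where
  orthonormal : Zᵀ * Z = 1
  span_eq : colSpace Z = colSpace X

/-- `P` is symmetric and the columns of `W` are orthonormal eigenvectors of `P` for its `K` largest
eigenvalues, counted with multiplicity: every eigenvalue of `P` that has an eigenvector orthogonal
to the columns of `W` is at most each of the eigenvalues `lam j` of the columns of `W`.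
The column space of `W` is the subspace `S_K(P)` spanned by the `K` leading eigenvectors. -/
structure IsLeadingEigenvectors {n K : ℕ} (P : Matrix (Fin n) (Fin n) ℝ)
    (W : Matrix (Fin n) (Fin K) ℝ) : Prop where
  symm : P.IsSymm
  orthonormal : Wᵀ * W = 1
  leading : ∃ lam : Fin K → ℝ, (∀ j, P *ᵥ W.col j = lam j • W.col j) ∧
    ∀ (c : ℝ) (v : Fin n → ℝ), v ≠ 0 → P *ᵥ v = c • v → Wᵀ *ᵥ v = 0 → ∀ j, c ≤ lam j

/-- The `p × k` rectangular diagonal matrix with diagonal entries `sv 0, sv 1, …`. -/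
def rectDiag (p k : ℕ) (sv : ℕ → ℝ) : Matrix (Fin p) (Fin k) ℝ :=
  Matrix.of fun i j => if (i : ℕ) = (j : ℕ) then sv i else 0

/-- `A = U Σ Vᵀ` is a (full) singular value decomposition of `A`. The singular values are listed in
decreasing order, starting from index `0`: the singular value usually called `σᵢ` is `sv (i - 1)`;
the list is continued by zeros. -/
structure IsSVD {p k : ℕ} (A : Matrix (Fin p) (Fin k) ℝ) (U : Matrix (Fin p) (Fin p) ℝ)
    (sv : ℕ → ℝ) (V : Matrix (Fin k) (Fin k) ℝ) : Prop where
  left_orth : Uᵀ * U = 1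
  right_orth : Vᵀ * V = 1
  antitone : Antitone sv
  nonneg : ∀ i, 0 ≤ sv i
  eq_zero : ∀ i, min p k ≤ i → sv i = 0
  factor : A = U * rectDiag p k sv * Vᵀ

/-- The submatrix of the first `r` columns. -/
def colsUpTo {n k : ℕ} (r : ℕ) (A : Matrix (Fin n) (Fin k) ℝ) :
    Matrix (Fin n) {j : Fin k // (j : ℕ) < r} ℝ :=
  A.submatrix id Subtype.val

/-- The submatrix of the columns number `r + 1, …, k` (indices `r, …, k - 1`). -/
def colsFrom {n k : ℕ} (r : ℕ) (A : Matrix (Fin n) (Fin k) ℝ) :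
    Matrix (Fin n) {j : Fin k // r ≤ (j : ℕ)} ℝ :=
  A.submatrix id Subtype.val

/-- The inverse square root `S^{-1/2}` of a symmetric positive definite matrix, by functional
calculus: `S` is diagonalized and each eigenvalue `x` is replaced by `1 / √x`. -/
def invSqrt {ι : Type*} [Fintype ι] [DecidableEq ι] (S : Matrix ι ι ℝ) : Matrix ι ι ℝ :=
  cfc (fun x : ℝ => (Real.sqrt x)⁻¹) S

/-! ### The model -/

/-- `R = col(X) ∩ S_K(P)`, where `S_K(P)` is the column space of `W`. -/
def overlap {n p K : ℕ} (X : Matrix (Fin n) (Fin p) ℝ) (W : Matrix (Fin n) (Fin K) ℝ) :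
    Submodule ℝ (Fin n → ℝ) :=
  colSpace X ⊓ colSpace W

/-- The mean `E Y = X β + X θ + α`. -/
def meanVec {n p : ℕ} (X : Matrix (Fin n) (Fin p) ℝ) (β θ : Fin p → ℝ) (α : Fin n → ℝ) :
    Fin n → ℝ :=
  X *ᵥ β + X *ᵥ θ + α

/-- The constraints on the parameters of the regression model with network effects. -/
structure IsModel {n p K : ℕ} (X : Matrix (Fin n) (Fin p) ℝ) (W : Matrix (Fin n) (Fin K) ℝ)
    (β θ : Fin p → ℝ) (α : Fin n → ℝ) : Prop where
  theta_mem : X *ᵥ θ ∈ overlap X W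
  beta_perp : ∀ v ∈ overlap X W, X *ᵥ β ⬝ᵥ v = 0
  alpha_mem : α ∈ colSpace W
  alpha_perp : ∀ v ∈ overlap X W, α ⬝ᵥ v = 0

/-! ### The algorithm -/

section Algorithm

variable {n p K : ℕ} (r : ℕ) (Z : Matrix (Fin n) (Fin p) ℝ) (What : Matrix (Fin n) (Fin K) ℝ)
  (Uhat : Matrix (Fin p) (Fin p) ℝ) (Vhat : Matrix (Fin K) (Fin K) ℝ)

/-- The matrix `M̂ = (Ẑ_{(r+1):p}, W̆_{(r+1):K})`, where `Ẑ = Z Û` and `W̆ = Ŵ V̂`. -/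
def Mhat : Matrix (Fin n) ({j : Fin p // r ≤ (j : ℕ)} ⊕ {j : Fin K // r ≤ (j : ℕ)}) ℝ :=
  Matrix.fromCols (colsFrom r (Z * Uhat)) (colsFrom r (What * Vhat))

/-- `P̂_R = Ẑ_{1:r} Ẑ_{1:r}ᵀ`. -/
def PRhat : Matrix (Fin n) (Fin n) ℝ :=
  colsUpTo r (Z * Uhat) * (colsUpTo r (Z * Uhat))ᵀ

/-- `P̂_C = (Ẑ_{(r+1):p}, 0) (M̂ᵀ M̂)⁻¹ M̂ᵀ`. -/
def PChat : Matrix (Fin n) (Fin n) ℝ :=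
  Matrix.fromCols (colsFrom r (Z * Uhat)) (0 : Matrix (Fin n) {j : Fin K // r ≤ (j : ℕ)} ℝ) *
    ((Mhat r Z What Uhat Vhat)ᵀ * Mhat r Z What Uhat Vhat)⁻¹ * (Mhat r Z What Uhat Vhat)ᵀ

/-- `P̂_N = (0, W̆_{(r+1):K}) (M̂ᵀ M̂)⁻¹ M̂ᵀ`. -/
def PNhat : Matrix (Fin n) (Fin n) ℝ :=
  Matrix.fromCols (0 : Matrix (Fin n) {j : Fin p // r ≤ (j : ℕ)} ℝ) (colsFrom r (What * Vhat)) *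
    ((Mhat r Z What Uhat Vhat)ᵀ * Mhat r Z What Uhat Vhat)⁻¹ * (Mhat r Z What Uhat Vhat)ᵀ

/-- `Ĥ = P̂_R + P̂_C + P̂_N`. -/
def Hhat : Matrix (Fin n) (Fin n) ℝ :=
  PRhat r Z Uhat + PChat r Z What Uhat Vhat + PNhat r Z What Uhat Vhat

/-- The variance estimate `σ̂² = ‖Y - Ĥ Y‖² / (n - p - K + r)`. -/
def sigmaHatSq (Y : Fin n → ℝ) : ℝ :=
  euclNorm (Y - Hhat r Z What Uhat Vhat *ᵥ Y) ^ 2 / ((n : ℝ) - p - K + r)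

/-- `γ̂ = W̆_{(r+1):K}ᵀ P̂_N Y`, a vector with `K - r` coordinates. -/
def gammaHat (Y : Fin n → ℝ) : {j : Fin K // r ≤ (j : ℕ)} → ℝ :=
  (colsFrom r (What * Vhat))ᵀ *ᵥ (PNhat r Z What Uhat Vhat *ᵥ Y)

/-- The estimated covariance matrix `σ̂² W̆_{(r+1):K}ᵀ P̂_N P̂_Nᵀ W̆_{(r+1):K}` of `γ̂`. -/
def covGammaHat (Y : Fin n → ℝ) :
    Matrix {j : Fin K // r ≤ (j : ℕ)} {j : Fin K // r ≤ (j : ℕ)} ℝ :=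
  sigmaHatSq r Z What Uhat Vhat Y •
    ((colsFrom r (What * Vhat))ᵀ * PNhat r Z What Uhat Vhat * (PNhat r Z What Uhat Vhat)ᵀ *
      colsFrom r (What * Vhat))

/-- The normalized estimate `γ̂₀`: the inverse square root of the estimated covariance matrix of
`γ̂`, applied to `γ̂`. -/
def gammaHatZero (Y : Fin n → ℝ) : {j : Fin K // r ≤ (j : ℕ)} → ℝ :=
  invSqrt (covGammaHat r Z What Uhat Vhat Y) *ᵥ gammaHat r Z What Uhat Vhat Y

end Algorithm

/-! ### Asymptotic assumptions -/

/-- Standardized scale: the columns of `X` have norm `√n` and `‖X β + X θ + α‖ ≤ C √(n p)`. -/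
def StandardizedScale (p : ℕ → ℕ) (X : ∀ n, Matrix (Fin n) (Fin (p n)) ℝ)
    (β θ : ∀ n, Fin (p n) → ℝ) (α : ∀ n, Fin n → ℝ) : Prop :=
  (∀ᶠ n in atTop, ∀ j, euclNorm ((X n).col j) = Real.sqrt n) ∧
  ∃ C : ℝ, 0 < C ∧
    ∀ᶠ n in atTop, euclNorm (meanVec (X n) (β n) (θ n) (α n)) ≤ C * Real.sqrt (n * p n)

/-- `τ_n = ‖(Ŵ Ŵᵀ - W Wᵀ) Z‖`. -/
def tau {n p K : ℕ} (Z : Matrix (Fin n) (Fin p) ℝ) (W What : Matrix (Fin n) (Fin K) ℝ) : ℝ :=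
  specNorm ((What * Whatᵀ - W * Wᵀ) * Z)

/-- `min {(1 - σ_{r+1})³, σ_{r+s}³}`, where `s` is the number of singular values strictly between
`0` and `1`; it is `1` if there are none (`s = 0`). -/
def gapCubed (r s : ℕ) (sv : ℕ → ℝ) : ℝ :=
  if s = 0 then 1 else min ((1 - sv r) ^ 3) (sv (r + s - 1) ^ 3)

/-- Small projection perturbation: `τ_n / min {(1 - σ_{r+1})³, σ_{r+s}³} = o(1 / √(n p))`. -/
def SmallPerturbation {K : ℕ} (r : ℕ) (s p : ℕ → ℕ) (Z : ∀ n, Matrix (Fin n) (Fin (p n)) ℝ)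
    (W What : ∀ n, Matrix (Fin n) (Fin K) ℝ) (sv : ℕ → ℕ → ℝ) : Prop :=
  (fun n => tau (Z n) (W n) (What n) / gapCubed r (s n) (sv n))
    =o[atTop] fun n : ℕ => 1 / Real.sqrt (n * p n)

/-! ### The chi-squared distribution -/

/-- The chi-squared distribution with `k` degrees of freedom: the law of the sum of the squares of
`k` independent standard normal variables (the point mass at `0` if `k = 0`). -/
def chiSquared (k : ℕ) : Measure ℝ :=
  (Measure.pi fun _ : Fin k => gaussianReal 0 1).map fun x => ∑ i, x i ^ 2

instance (k : ℕ) : IsProbabilityMeasure (chiSquared k) :=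
  Measure.isProbabilityMeasure_map
    (Finset.measurable_sum _ fun i _ => (measurable_pi_apply i).pow_const 2).aemeasurable

end NetReg

end

namespace NetReg

/-! ### Linear algebra of the estimator -/

section Estimator

open Matrix

variable {n p K r : ℕ} {Z : Matrix (Fin n) (Fin p) ℝ} {W : Matrix (Fin n) (Fin K) ℝ}
  {U : Matrix (Fin p) (Fin p) ℝ} {V : Matrix (Fin K) (Fin K) ℝ} {sv : ℕ → ℝ}

/-! Under the null hypothesis the mean `Xβ + Xθ` lies in `col Z`, and the estimator, although built
from the perturbed `Ŵ`, treats `col Z` exactly. As soon as `M̂` has full column rank, `P̂_N`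
annihilates `Z` (`PNhat_mul_Z`), and `Ĥ` is an orthogonal projection of rank `p + K - r` that fixes
`Z` (`Hhat_mul_Z`, `isIdempotentElem_Hhat`, `trace_Hhat`). Hence there is no bias: `γ̂ = A ε` for a
deterministic `A`, the residual is `(1 - Ĥ) ε`, and `‖γ̂₀‖²` is the quotient of `‖(A Aᵀ)^{-1/2} A
ε‖² / σ²` by `σ̂² / σ²` (`euclNorm_gammaHatZero_sq_add`).

The rows of `(A Aᵀ)^{-1/2} A` are orthonormal, so the numerator has law `χ²_{K-r}` exactly. The
denominator has the law of `χ²_d / d` with `d = n - p - K + r`, which tends to infinity because `p =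
o(n)`; by Chebyshev it tends to `1` in probability, and Slutsky's theorem concludes. Independence of
the two is not needed.

It remains to see that `M̂` has full rank for large `n`, which follows from `σ̂_{r+1} < 1`
(`mulVec_Mhat_injective`). The unperturbed value satisfies `σ_{r+1} < 1` since the overlap has
dimension `r` (`singularValue_lt_one`). A Courant–Fischer argument transfers this to `σ̂_{r+1}` when
`σ_{r+1}² + τ < 1` (`singularValue_hat_lt_one`), and the perturbation assumption makes `τ` small
against the gap. -/

theorem transpose_mul_self_mul_orthogonal {m k : ℕ} {A : Matrix (Fin m) (Fin k) ℝ}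
    {Q : Matrix (Fin k) (Fin k) ℝ} (hA : Aᵀ * A = 1) (hQ : Qᵀ * Q = 1) :
    (A * Q)ᵀ * (A * Q) = 1 := by
  rw [transpose_mul, Matrix.mul_assoc, ← Matrix.mul_assoc Aᵀ, hA, Matrix.one_mul, hQ]

theorem IsSVD.transpose_mul_rotated (h : IsSVD (Zᵀ * W) U sv V) :
    (Z * U)ᵀ * (W * V) = rectDiag p K sv := by
  calc (Z * U)ᵀ * (W * V) = Uᵀ * (Zᵀ * W) * V := by
        rw [transpose_mul]; simp only [Matrix.mul_assoc]
    _ = (Uᵀ * U) * rectDiag p K sv * (Vᵀ * V) := by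
        rw [h.factor]; simp only [Matrix.mul_assoc]
    _ = rectDiag p K sv := by rw [h.left_orth, h.right_orth, Matrix.one_mul, Matrix.mul_one]

theorem transpose_colsFrom_mul_colsFrom {m k l : ℕ} (A : Matrix (Fin m) (Fin k) ℝ)
    (B : Matrix (Fin m) (Fin l) ℝ) :
    (colsFrom r A)ᵀ * colsFrom r B = (Aᵀ * B).submatrix Subtype.val Subtype.val := rfl

theorem transpose_colsUpTo_mul_colsFrom {m k l : ℕ} (A : Matrix (Fin m) (Fin k) ℝ)
    (B : Matrix (Fin m) (Fin l) ℝ) :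
    (colsUpTo r A)ᵀ * colsFrom r B = (Aᵀ * B).submatrix Subtype.val Subtype.val := rfl

theorem transpose_colsUpTo_mul_colsUpTo {m k l : ℕ} (A : Matrix (Fin m) (Fin k) ℝ)
    (B : Matrix (Fin m) (Fin l) ℝ) :
    (colsUpTo r A)ᵀ * colsUpTo r B = (Aᵀ * B).submatrix Subtype.val Subtype.val := rfl

theorem transpose_colsFrom_mul_self {m k : ℕ} {A : Matrix (Fin m) (Fin k) ℝ} (hA : Aᵀ * A = 1) :
    (colsFrom r A)ᵀ * colsFrom r A = 1 := by
  rw [transpose_colsFrom_mul_colsFrom, hA, submatrix_one _ Subtype.val_injective]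

theorem transpose_colsUpTo_mul_self {m k : ℕ} {A : Matrix (Fin m) (Fin k) ℝ} (hA : Aᵀ * A = 1) :
    (colsUpTo r A)ᵀ * colsUpTo r A = 1 := by
  rw [transpose_colsUpTo_mul_colsUpTo, hA, submatrix_one _ Subtype.val_injective]

theorem transpose_colsUpTo_mul_colsFrom_self {m k : ℕ} {A : Matrix (Fin m) (Fin k) ℝ}
    (hA : Aᵀ * A = 1) : (colsUpTo r A)ᵀ * colsFrom r A = 0 := by
  rw [transpose_colsUpTo_mul_colsFrom, hA]
  ext i j
  have hi := i.2
  have hj := j.2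
  have : (i : Fin k) ≠ j := fun h => by rw [h] at hi; omega
  simp [this]

/-- The singular vectors `Ẑ_{1:r}` are orthogonal to all columns of `M̂`. -/
theorem transpose_colsUpTo_mul_Mhat (hZ : Zᵀ * Z = 1) (h : IsSVD (Zᵀ * W) U sv V) :
    (colsUpTo r (Z * U))ᵀ * Mhat r Z W U V = 0 := by
  have h1 := transpose_colsUpTo_mul_colsFrom_self (r := r)
    (transpose_mul_self_mul_orthogonal hZ h.left_orth)
  have h2 : (colsUpTo r (Z * U))ᵀ * colsFrom r (W * V) = 0 := by
    rw [transpose_colsUpTo_mul_colsFrom, h.transpose_mul_rotated]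
    ext i j
    have hi := i.2
    have hj := j.2
    have : ((i : Fin p) : ℕ) ≠ (j : Fin K) := by omega
    simp [rectDiag, this]
  rw [Mhat, mul_fromCols, h1, h2, fromCols_zero]

/-- The two blocks `C`, `B` of `M̂` have orthonormal columns and the diagonal cross-Gram matrix `D =
Cᵀ B`. Applying `Cᵀ` and `Bᵀ` to `C x + B y = 0` gives `x = -D y` and `y = Dᵀ D y`; the entries of
`Dᵀ D` are squares of singular values below `1`, or `0`, so `y = 0`. -/
theorem mulVec_Mhat_injective (hZ : Zᵀ * Z = 1) (hW : Wᵀ * W = 1) (h : IsSVD (Zᵀ * W) U sv V)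
    (hlt : sv r < 1) : Function.Injective (Mhat r Z W U V).mulVec := by
  have hC := transpose_colsFrom_mul_self (r := r)
    (transpose_mul_self_mul_orthogonal hZ h.left_orth)
  have hB := transpose_colsFrom_mul_self (r := r)
    (transpose_mul_self_mul_orthogonal hW h.right_orth)
  have hD : (colsFrom r (Z * U))ᵀ * colsFrom r (W * V) =
      (rectDiag p K sv).submatrix Subtype.val Subtype.val := by
    rw [transpose_colsFrom_mul_colsFrom, h.transpose_mul_rotated]
  set C := colsFrom r (Z * U)
  set B := colsFrom r (W * V)
  set D : Matrix {j : Fin p // r ≤ (j : ℕ)} {j : Fin K // r ≤ (j : ℕ)} ℝ :=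
    (rectDiag p K sv).submatrix Subtype.val Subtype.val
  refine (injective_iff_map_eq_zero (Mhat r Z W U V).mulVecLin).2 fun v hv => ?_
  obtain ⟨x, y, rfl⟩ : ∃ x y, v = Sum.elim x y := ⟨_, _, (Sum.elim_comp_inl_inr v).symm⟩
  have hxy : C *ᵥ x + B *ᵥ y = 0 := by
    rw [← fromCols_mulVec_sumElim]; exact hv
  have hx : x = -(D *ᵥ y) := by
    have := congrArg (fun w => Cᵀ *ᵥ w) hxy
    simp only [mulVec_add, mulVec_mulVec, hC, hD, one_mulVec, mulVec_zero] at this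
    exact eq_neg_of_add_eq_zero_left this
  have hBC : Bᵀ * C = Dᵀ := by rw [← hD, transpose_mul, transpose_transpose]
  have hy : y = (Dᵀ * D) *ᵥ y := by
    have := congrArg (fun w => Bᵀ *ᵥ w) hxy
    simp only [mulVec_add, mulVec_mulVec, hB, hBC, one_mulVec, mulVec_zero] at this
    rw [hx, mulVec_neg, mulVec_mulVec] at this
    exact (neg_add_eq_zero.1 this).symm
  -- `D` is rectangular: a column with index at least `p` has no diagonal entry and vanishes, hence
  -- the case distinction.
  have hdiag : Dᵀ * D = diagonal fun j : {j : Fin K // r ≤ (j : ℕ)} =>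
      if ((j : Fin K) : ℕ) < p then sv (j : Fin K) ^ 2 else 0 := by
    ext i j
    have e : (Dᵀ * D) i j = ∑ k : {j : Fin p // r ≤ (j : ℕ)},
        if ((k : Fin p) : ℕ) = (i : Fin K) then
          (if ((k : Fin p) : ℕ) = (j : Fin K) then sv (k : Fin p) * sv (k : Fin p) else 0)
        else 0 := by
      simp only [mul_apply, transpose_apply, D, submatrix_apply, rectDiag, of_apply]
      refine Finset.sum_congr rfl fun k _ => ?_
      split_ifs <;> simp
    rw [e, diagonal_apply]
    by_cases hp : ((i : Fin K) : ℕ) < p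
    · rw [Finset.sum_eq_single (⟨⟨(i : Fin K), hp⟩, i.2⟩ : {j : Fin p // r ≤ (j : ℕ)})]
      · by_cases hij : i = j
        · subst hij
          simp [hp, sq]
        · have : ((i : Fin K) : ℕ) ≠ (j : Fin K) := fun h => hij (Subtype.ext (Fin.ext h))
          simp [hij, this]
      · intro k _ hk
        rw [if_neg]
        exact fun h => hk (Subtype.ext (Fin.ext h))
      · simp
    · rw [Finset.sum_eq_zero]
      · simp [hp]
      · intro k _
        rw [if_neg]
        have := (k : Fin p).2
        omega
  have hy0 : y = 0 := by
    funext j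
    have hj := congrFun hy j
    rw [hdiag, mulVec_diagonal] at hj
    have h1 : sv (j : Fin K) < 1 := (h.antitone j.2).trans_lt hlt
    have h2 : (if ((j : Fin K) : ℕ) < p then sv (j : Fin K) ^ 2 else 0) < 1 := by
      split_ifs
      · exact pow_lt_one₀ (h.nonneg _) h1 two_ne_zero
      · exact one_pos
    have h3 : (1 - if ((j : Fin K) : ℕ) < p then sv (j : Fin K) ^ 2 else 0) * y j = 0 := by
      rw [sub_mul, one_mul]; linarith
    exact (mul_eq_zero.1 h3).resolve_left (sub_ne_zero.2 h2.ne')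
  rw [hx, hy0]
  ext (i | i) <;> simp

/-- Exhibits `Ẑ_{(r+1):p}` as `M̂` times a coordinate selector, so that `(M̂ᵀ M̂)⁻¹ M̂ᵀ M̂` cancels
in products with it. -/
theorem Mhat_mul_fromRows_one_zero :
    Mhat r Z W U V *
      fromRows (1 : Matrix {j : Fin p // r ≤ (j : ℕ)} {j : Fin p // r ≤ (j : ℕ)} ℝ)
        (0 : Matrix {j : Fin K // r ≤ (j : ℕ)} {j : Fin p // r ≤ (j : ℕ)} ℝ) = colsFrom r (Z * U) := by
  rw [Mhat, fromCols_mul_fromRows, Matrix.mul_one, Matrix.mul_zero, add_zero]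

theorem posDef_gram_Mhat (hZ : Zᵀ * Z = 1) (hW : Wᵀ * W = 1) (h : IsSVD (Zᵀ * W) U sv V)
    (hlt : sv r < 1) : ((Mhat r Z W U V)ᵀ * Mhat r Z W U V).PosDef := by
  rw [← conjTranspose_eq_transpose_of_trivial]
  exact PosDef.conjTranspose_mul_self _ (mulVec_Mhat_injective hZ hW h hlt)

/-- A matrix that annihilates `Ẑ_{1:r}` and `Ẑ_{(r+1):p}` annihilates `Z`. -/
theorem mul_eq_zero_of_mul_cols_eq_zero {m : Type*} {A : Matrix m (Fin n) ℝ} (hU : Uᵀ * U = 1)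
    (h1 : A * colsUpTo r (Z * U) = 0) (h2 : A * colsFrom r (Z * U) = 0) : A * Z = 0 := by
  have h : A * (Z * U) = 0 := by
    ext i j
    by_cases hj : (j : ℕ) < r
    · exact congrFun (congrFun h1 i) ⟨j, hj⟩
    · exact congrFun (congrFun h2 i) ⟨j, not_lt.1 hj⟩
  have hU' : U * Uᵀ = 1 := mul_eq_one_comm.1 hU
  calc A * Z = A * (Z * U) * Uᵀ := by
        rw [Matrix.mul_assoc, Matrix.mul_assoc, hU', Matrix.mul_one]
    _ = 0 := by rw [h, Matrix.zero_mul]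

/-- The oblique projection `P̂_N` vanishes on the column space of the design. -/
theorem PNhat_mul_Z (hZ : Zᵀ * Z = 1) (hW : Wᵀ * W = 1) (h : IsSVD (Zᵀ * W) U sv V)
    (hlt : sv r < 1) : PNhat r Z W U V * Z = 0 := by
  refine mul_eq_zero_of_mul_cols_eq_zero (r := r) h.left_orth ?_ ?_
  · have := congrArg transpose (transpose_colsUpTo_mul_Mhat (r := r) hZ h)
    rw [transpose_mul, transpose_transpose, transpose_zero] at this
    rw [PNhat, Matrix.mul_assoc, this, Matrix.mul_zero]
  -- After the cancellation, only the `W̆`-coefficients of `Ẑ_{(r+1):p}` with respect to `M̂`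
  -- remain, and these are zero.
  · have hdet := (Matrix.isUnit_iff_isUnit_det _).1 (posDef_gram_Mhat hZ hW h hlt).isUnit
    rw [← Mhat_mul_fromRows_one_zero (W := W) (V := V), PNhat, ← Matrix.mul_assoc, Matrix.mul_assoc _ _ (Mhat r Z W U V),
      Matrix.mul_assoc _ _ ((Mhat r Z W U V)ᵀ * Mhat r Z W U V), nonsing_inv_mul _ hdet,
      Matrix.mul_one, fromCols_mul_fromRows, Matrix.mul_one, Matrix.mul_zero, add_zero]

/-- The oblique pieces `P̂_C` and `P̂_N` add up to the orthogonal projection onto `col M̂` when the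
Gram matrix is invertible. -/
theorem Hhat_eq : Hhat r Z W U V = colsUpTo r (Z * U) * (colsUpTo r (Z * U))ᵀ +
    Mhat r Z W U V * ((Mhat r Z W U V)ᵀ * Mhat r Z W U V)⁻¹ * (Mhat r Z W U V)ᵀ := by
  have : Mhat r Z W U V = fromCols (colsFrom r (Z * U)) 0 + fromCols 0 (colsFrom r (W * V)) := by
    ext i (j | j) <;> simp [Mhat]
  rw [Hhat, PRhat, PChat, PNhat, add_assoc, ← Matrix.add_mul, ← Matrix.add_mul, ← this]

theorem Hhat_mul_Mhat (hZ : Zᵀ * Z = 1) (hW : Wᵀ * W = 1) (h : IsSVD (Zᵀ * W) U sv V)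
    (hlt : sv r < 1) : Hhat r Z W U V * Mhat r Z W U V = Mhat r Z W U V := by
  have hdet := (Matrix.isUnit_iff_isUnit_det _).1 (posDef_gram_Mhat hZ hW h hlt).isUnit
  rw [Hhat_eq, Matrix.add_mul, Matrix.mul_assoc _ _ (Mhat r Z W U V),
    transpose_colsUpTo_mul_Mhat hZ h, Matrix.mul_zero, zero_add,
    Matrix.mul_assoc _ _ (Mhat r Z W U V), Matrix.mul_assoc, nonsing_inv_mul _ hdet, Matrix.mul_one]

theorem Hhat_mul_colsUpTo (hZ : Zᵀ * Z = 1) (h : IsSVD (Zᵀ * W) U sv V) :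
    Hhat r Z W U V * colsUpTo r (Z * U) = colsUpTo r (Z * U) := by
  have h0 := congrArg transpose (transpose_colsUpTo_mul_Mhat (r := r) hZ h)
  rw [transpose_mul, transpose_transpose, transpose_zero] at h0
  rw [Hhat_eq, Matrix.add_mul, Matrix.mul_assoc, Matrix.mul_assoc _ _ (colsUpTo r (Z * U)),
    transpose_colsUpTo_mul_self (transpose_mul_self_mul_orthogonal hZ h.left_orth), h0,
    Matrix.mul_one, Matrix.mul_zero, add_zero]

theorem Hhat_mul_Z (hZ : Zᵀ * Z = 1) (hW : Wᵀ * W = 1) (h : IsSVD (Zᵀ * W) U sv V)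
    (hlt : sv r < 1) : Hhat r Z W U V * Z = Z := by
  have h0 : (Hhat r Z W U V - 1) * Z = 0 := by
    refine mul_eq_zero_of_mul_cols_eq_zero (r := r) h.left_orth ?_ ?_
    · rw [Matrix.sub_mul, Hhat_mul_colsUpTo hZ h, Matrix.one_mul, sub_self]
    · rw [← Mhat_mul_fromRows_one_zero (W := W) (V := V), ← Matrix.mul_assoc, Matrix.sub_mul,
        Hhat_mul_Mhat hZ hW h hlt, Matrix.one_mul, sub_self, Matrix.zero_mul]
  rwa [Matrix.sub_mul, Matrix.one_mul, sub_eq_zero] at h0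

theorem transpose_Hhat : (Hhat r Z W U V)ᵀ = Hhat r Z W U V := by
  simp only [Hhat_eq, transpose_add, transpose_mul, transpose_transpose, transpose_nonsing_inv,
    Matrix.mul_assoc]

theorem isIdempotentElem_Hhat (hZ : Zᵀ * Z = 1) (hW : Wᵀ * W = 1) (h : IsSVD (Zᵀ * W) U sv V)
    (hlt : sv r < 1) : IsIdempotentElem (Hhat r Z W U V) := by
  rw [IsIdempotentElem]
  nth_rw 2 [Hhat_eq]
  rw [Matrix.mul_add, ← Matrix.mul_assoc, ← Matrix.mul_assoc, ← Matrix.mul_assoc,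
    Hhat_mul_colsUpTo hZ h, Hhat_mul_Mhat hZ hW h hlt, ← Hhat_eq]

theorem card_lt_subtype {k r : ℕ} (h : r ≤ k) : Fintype.card {j : Fin k // (j : ℕ) < r} = r := by
  rw [Fintype.card_subtype, Fin.card_filter_val_lt, min_eq_right h]

theorem card_ge_subtype (k r : ℕ) : Fintype.card {j : Fin k // r ≤ (j : ℕ)} = k - r := by
  have := Fintype.card_subtype_compl fun j : Fin k => (j : ℕ) < r
  simp only [not_lt, Fintype.card_fin, Fintype.card_subtype, Fin.card_filter_val_lt] at this ⊢
  omega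

/-- Cyclicity of the trace turns the two summands of `Ĥ` into identity matrices of sizes `r` and `(p
- r) + (K - r)`. -/
theorem trace_Hhat (hZ : Zᵀ * Z = 1) (hW : Wᵀ * W = 1) (h : IsSVD (Zᵀ * W) U sv V)
    (hlt : sv r < 1) (hrp : r ≤ p) (hrK : r ≤ K) :
    (Hhat r Z W U V).trace = (p : ℝ) + K - r := by
  have hdet := (Matrix.isUnit_iff_isUnit_det _).1 (posDef_gram_Mhat hZ hW h hlt).isUnit
  rw [Hhat_eq, trace_add, trace_mul_comm,
    transpose_colsUpTo_mul_self (transpose_mul_self_mul_orthogonal hZ h.left_orth),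
    trace_mul_comm, ← Matrix.mul_assoc, mul_nonsing_inv _ hdet, trace_one, trace_one,
    card_lt_subtype hrp, Fintype.card_sum, card_ge_subtype, card_ge_subtype]
  push_cast [hrp, hrK]
  ring

/-- The matrix `W̆_{(r+1):K}ᵀ P̂_N` of the estimate `γ̂`. -/
noncomputable def gammaMatrix (r : ℕ) (Z : Matrix (Fin n) (Fin p) ℝ) (W : Matrix (Fin n) (Fin K) ℝ)
    (U : Matrix (Fin p) (Fin p) ℝ) (V : Matrix (Fin K) (Fin K) ℝ) :
    Matrix {j : Fin K // r ≤ (j : ℕ)} (Fin n) ℝ :=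
  (colsFrom r (W * V))ᵀ * PNhat r Z W U V

/-- Orthonormality of `W̆` cancels `W̆ᵀ W̆`: `γ̂` is the second block of the least-squares
coefficients on `M̂`. -/
theorem gammaMatrix_eq (hW : Wᵀ * W = 1) (hV : Vᵀ * V = 1) :
    gammaMatrix r Z W U V =
      fromCols (0 : Matrix {j : Fin K // r ≤ (j : ℕ)} {j : Fin p // r ≤ (j : ℕ)} ℝ)
        (1 : Matrix {j : Fin K // r ≤ (j : ℕ)} {j : Fin K // r ≤ (j : ℕ)} ℝ) * ((Mhat r Z W U V)ᵀ * Mhat r Z W U V)⁻¹ * (Mhat r Z W U V)ᵀ := by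
  rw [gammaMatrix, PNhat, ← Matrix.mul_assoc, ← Matrix.mul_assoc, mul_fromCols, Matrix.mul_zero,
    transpose_colsFrom_mul_self (transpose_mul_self_mul_orthogonal hW hV)]

/-- The normalized covariance matrix of `γ̂` is positive definite. -/
theorem posDef_gammaMatrix_mul_transpose (hZ : Zᵀ * Z = 1) (hW : Wᵀ * W = 1)
    (h : IsSVD (Zᵀ * W) U sv V) (hlt : sv r < 1) :
    (gammaMatrix r Z W U V * (gammaMatrix r Z W U V)ᵀ).PosDef := by
  have hpd := posDef_gram_Mhat hZ hW h hlt
  have hdet := (Matrix.isUnit_iff_isUnit_det _).1 hpd.isUnit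
  have hA : gammaMatrix r Z W U V = _ := gammaMatrix_eq hW h.right_orth
  set E : Matrix {j : Fin K // r ≤ (j : ℕ)}
    ({j : Fin p // r ≤ (j : ℕ)} ⊕ {j : Fin K // r ≤ (j : ℕ)}) ℝ := fromCols 0 1 with hEdef
  set M := Mhat r Z W U V
  have hE : Eᵀ.mulVec.Injective := by
    intro x y hxy
    have := congrArg (fun v => v ∘ Sum.inr) hxy
    simpa [hEdef, transpose_fromCols, fromRows_mulVec] using this
  -- `A Aᵀ` is the lower right block of the inverse Gram matrix, a compression of a positive
  -- definite matrix.
  have e : gammaMatrix r Z W U V * (gammaMatrix r Z W U V)ᵀ = Eᵀᴴ * (Mᵀ * M)⁻¹ * Eᵀ := by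
    rw [hA, conjTranspose_eq_transpose_of_trivial]
    simp only [transpose_mul, transpose_transpose, transpose_nonsing_inv]
    calc _ = E * (Mᵀ * M)⁻¹ * ((Mᵀ * M) * (Mᵀ * M)⁻¹) * Eᵀ := by simp only [Matrix.mul_assoc]
      _ = _ := by rw [mul_nonsing_inv _ hdet, Matrix.mul_one]
  rw [e]
  exact hpd.inv.conjTranspose_mul_mul_same hE

end Estimator

/-! ### Inverse square roots -/

section InvSqrt

open Matrix

variable {ι : Type*} [Fintype ι] [DecidableEq ι]

/-- No sign of `c` is needed: `√(c x) = √c √x` whenever `x ≥ 0`, and the spectrum of `S` is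
nonnegative. The function `(√x)⁻¹` may jump at `0`, but every function is continuous on a finite
spectrum. -/
theorem invSqrt_smul (c : ℝ) {S : Matrix ι ι ℝ} (hS : S.PosSemidef) :
    invSqrt (c • S) = (Real.sqrt c)⁻¹ • invSqrt S := by
  have hsa : IsSelfAdjoint S := hS.isHermitian
  have hfin : (spectrum ℝ S).Finite := Matrix.finite_real_spectrum
  have hfin' : ((c • ·) '' spectrum ℝ S).Finite := hfin.image _
  rw [invSqrt, invSqrt, ← cfc_comp_smul c _ S (hfin'.continuousOn _) hsa,
    ← cfc_smul _ _ S (hfin.continuousOn _)]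
  refine cfc_congr fun x hx => ?_
  have hx0 : 0 ≤ x := (posSemidef_iff_isHermitian_and_spectrum_nonneg.1 hS).2 hx
  simp only [smul_eq_mul]
  rw [Real.sqrt_mul' _ hx0, mul_inv]

theorem transpose_invSqrt (S : Matrix ι ι ℝ) : (invSqrt S)ᵀ = invSqrt S := by
  rw [← conjTranspose_eq_transpose_of_trivial]
  exact cfc_predicate (R := ℝ) (p := IsSelfAdjoint) _ S

theorem invSqrt_mul_self_mul_invSqrt {S : Matrix ι ι ℝ} (hS : S.PosDef) :
    invSqrt S * S * invSqrt S = 1 := by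
  have hsa : IsSelfAdjoint S := hS.isHermitian
  have hfin : (spectrum ℝ S).Finite := Matrix.finite_real_spectrum
  have e : invSqrt S * S * invSqrt S =
      cfc (fun x : ℝ => (Real.sqrt x)⁻¹ * x * (Real.sqrt x)⁻¹) S := by
    rw [cfc_mul _ _ S (hfin.continuousOn _) (hfin.continuousOn _),
      cfc_mul _ _ S (hfin.continuousOn _) (hfin.continuousOn _), cfc_id' ℝ S, invSqrt]
  rw [e, ← cfc_one ℝ S]
  refine cfc_congr fun x hx => ?_
  have hx0 : 0 < x := by
    rw [hS.isHermitian.spectrum_real_eq_range_eigenvalues] at hx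
    obtain ⟨i, rfl⟩ := hx
    exact hS.eigenvalues_pos i
  have h1 : Real.sqrt x ≠ 0 := (Real.sqrt_pos.2 hx0).ne'
  have h2 : x = Real.sqrt x * Real.sqrt x := (Real.mul_self_sqrt hx0.le).symm
  simp only [Pi.one_apply]
  nth_rw 2 [h2]
  field_simp

end InvSqrt

/-! ### Singular values -/

section SingularValues

open Matrix

theorem euclNorm_sq {ι : Type*} [Fintype ι] (v : ι → ℝ) : euclNorm v ^ 2 = v ⬝ᵥ v := by
  rw [euclNorm, EuclideanSpace.real_norm_sq_eq, dotProduct]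
  simp [sq]

theorem euclNorm_nonneg {ι : Type*} [Fintype ι] (v : ι → ℝ) : 0 ≤ euclNorm v := norm_nonneg _

theorem euclNorm_mulVec_le {n k : ℕ} (A : Matrix (Fin n) (Fin k) ℝ) (x : Fin k → ℝ) :
    euclNorm (A *ᵥ x) ≤ specNorm A * euclNorm x :=
  Matrix.l2_opNorm_mulVec A (WithLp.toLp 2 x)

theorem dotProduct_le_euclNorm_mul {ι : Type*} [Fintype ι] (v w : ι → ℝ) :
    v ⬝ᵥ w ≤ euclNorm v * euclNorm w := by
  have := real_inner_le_norm (WithLp.toLp 2 w) (WithLp.toLp 2 v)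
  rw [EuclideanSpace.inner_toLp_toLp, star_trivial] at this
  rw [mul_comm]
  exact this

theorem dotProduct_mulVec_self {m k : Type*} [Fintype m] [Fintype k] (A : Matrix m k ℝ)
    (x : k → ℝ) : A *ᵥ x ⬝ᵥ A *ᵥ x = x ⬝ᵥ (Aᵀ * A) *ᵥ x := by
  rw [dotProduct_mulVec, vecMul_mulVec, ← dotProduct_mulVec]

/-! ### Squared singular values as eigenvalues of `A Aᵀ`, and the rank. -/

section General

variable {p k : ℕ} {A : Matrix (Fin p) (Fin k) ℝ} {U : Matrix (Fin p) (Fin p) ℝ}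
  {V : Matrix (Fin k) (Fin k) ℝ} {sv : ℕ → ℝ}

theorem rectDiag_mul_transpose (h0 : ∀ i, min p k ≤ i → sv i = 0) :
    rectDiag p k sv * (rectDiag p k sv)ᵀ = diagonal fun i : Fin p => sv i ^ 2 := by
  ext i j
  have e : (rectDiag p k sv * (rectDiag p k sv)ᵀ) i j = ∑ l : Fin k,
      if (i : ℕ) = (l : ℕ) then (if (j : ℕ) = (l : ℕ) then sv i * sv j else 0) else 0 := by
    simp only [mul_apply, transpose_apply, rectDiag, of_apply]
    refine Finset.sum_congr rfl fun l _ => ?_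
    split_ifs <;> simp
  rw [e, diagonal_apply]
  by_cases hk : (i : ℕ) < k
  · rw [Finset.sum_eq_single (⟨i, hk⟩ : Fin k)]
    · by_cases hij : i = j
      · subst hij
        simp [sq]
      · have : (j : ℕ) ≠ i := fun h => hij (Fin.ext h.symm)
        simp [hij, this]
    · intro l _ hl
      rw [if_neg]
      exact fun h => hl (Fin.ext h.symm)
    · simp
  -- Row `i ≥ k` of the rectangular matrix is zero; on the other side, `sv i` is zero by the
  -- convention on the continued list.
  · rw [Finset.sum_eq_zero, h0 i (by omega)]
    · simp
    · intro l _
      rw [if_neg]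
      have := l.2
      omega

theorem IsSVD.mul_transpose (h : IsSVD A U sv V) :
    A * Aᵀ = U * diagonal (fun i : Fin p => sv i ^ 2) * Uᵀ := by
  rw [← rectDiag_mul_transpose h.eq_zero, h.factor]
  simp only [transpose_mul, transpose_transpose]
  calc _ = U * rectDiag p k sv * (Vᵀ * V) * (rectDiag p k sv)ᵀ * Uᵀ := by
        simp only [Matrix.mul_assoc]
    _ = _ := by rw [h.right_orth, Matrix.mul_one]; simp only [Matrix.mul_assoc]

theorem IsSVD.dotProduct_transpose_mulVec (h : IsSVD A U sv V) (x : Fin p → ℝ) :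
    Aᵀ *ᵥ x ⬝ᵥ Aᵀ *ᵥ x = ∑ i : Fin p, sv i ^ 2 * (Uᵀ *ᵥ x) i ^ 2 := by
  rw [dotProduct_mulVec_self, transpose_transpose, h.mul_transpose, ← mulVec_mulVec,
    ← mulVec_mulVec, dotProduct_mulVec, ← mulVec_transpose, dotProduct]
  refine Finset.sum_congr rfl fun i _ => ?_
  rw [mulVec_diagonal]
  ring

theorem dotProduct_transpose_mulVec_orthogonal (hU : Uᵀ * U = 1) (x : Fin p → ℝ) :
    ∑ i, (Uᵀ *ᵥ x) i ^ 2 = x ⬝ᵥ x := by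
  have h := dotProduct_mulVec_self Uᵀ x
  rw [transpose_transpose, mul_eq_one_comm.1 hU, one_mulVec] at h
  rw [← h, dotProduct]
  exact Finset.sum_congr rfl fun i _ => sq _

theorem IsSVD.rank_eq (h : IsSVD A U sv V) :
    A.rank = Fintype.card {i : Fin p // sv i ^ 2 ≠ 0} := by
  have hU : IsUnit U.det :=
    (Matrix.isUnit_iff_isUnit_det _).1 (IsUnit.of_mul_eq_one_right _ h.left_orth)
  have hU' : IsUnit Uᵀ.det := by rwa [det_transpose]
  rw [← rank_self_mul_transpose, h.mul_transpose, rank_mul_eq_left_of_isUnit_det _ _ hU',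
    rank_mul_eq_right_of_isUnit_det _ _ hU, Matrix.rank_diagonal]

theorem IsSVD.eq_zero_of_rank_le (h : IsSVD A U sv V) {m : ℕ} (hm : A.rank ≤ m) : sv m = 0 := by
  by_contra hne
  have hmp : m < p := by
    by_contra hcon
    exact hne (h.eq_zero m (by omega))
  have hpos : 0 < sv m := lt_of_le_of_ne (h.nonneg m) (Ne.symm hne)
  have hcard := Fintype.card_le_of_injective
    (fun i : Fin (m + 1) => (⟨⟨i, by omega⟩,
      (pow_pos (hpos.trans_le (h.antitone (Nat.lt_succ_iff.1 i.2))) 2).ne'⟩ :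
        {i : Fin p // sv i ^ 2 ≠ 0}))
    (fun i j hij => by simpa [Fin.ext_iff] using hij)
  rw [← h.rank_eq, Fintype.card_fin] at hcard
  omega

theorem IsSVD.pos_of_lt_rank (h : IsSVD A U sv V) {m : ℕ} (hm : m < A.rank) : 0 < sv m := by
  refine lt_of_le_of_ne (h.nonneg m) fun h0 => ?_
  have hlt : ∀ i : {i : Fin p // sv i ^ 2 ≠ 0}, (i : ℕ) < m := fun i => by
    by_contra hcon
    have h1 := h.antitone (not_lt.1 hcon)
    have h2 : sv (i : Fin p) = 0 := le_antisymm (h1.trans h0.symm.le) (h.nonneg _)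
    exact i.2 (by rw [h2]; norm_num)
  have hcard := Fintype.card_le_of_injective
    (fun i : {i : Fin p // sv i ^ 2 ≠ 0} => (⟨i, hlt i⟩ : Fin m))
    (fun i j hij => by simpa [Fin.ext_iff, Subtype.ext_iff] using hij)
  rw [← h.rank_eq, Fintype.card_fin] at hcard
  omega

end General

variable {n p K r : ℕ} {X Z : Matrix (Fin n) (Fin p) ℝ} {W What : Matrix (Fin n) (Fin K) ℝ}
  {U Uhat : Matrix (Fin p) (Fin p) ℝ} {V Vhat : Matrix (Fin K) (Fin K) ℝ} {sv svhat : ℕ → ℝ}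

/-- A vector whose orthogonal projection onto the column space of `W` is not shorter
lies in that column space. -/
theorem mem_colSpace_of_dotProduct_le (hW : Wᵀ * W = 1) {z : Fin n → ℝ}
    (h : z ⬝ᵥ z ≤ Wᵀ *ᵥ z ⬝ᵥ Wᵀ *ᵥ z) : z ∈ colSpace W := by
  have e1 : W *ᵥ (Wᵀ *ᵥ z) ⬝ᵥ W *ᵥ (Wᵀ *ᵥ z) = Wᵀ *ᵥ z ⬝ᵥ Wᵀ *ᵥ z := by
    rw [dotProduct_mulVec_self, hW, one_mulVec]
  have e2 : z ⬝ᵥ W *ᵥ (Wᵀ *ᵥ z) = Wᵀ *ᵥ z ⬝ᵥ Wᵀ *ᵥ z := by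
    rw [dotProduct_mulVec, ← mulVec_transpose]
  have e3 : (z - W *ᵥ (Wᵀ *ᵥ z)) ⬝ᵥ (z - W *ᵥ (Wᵀ *ᵥ z)) ≤ 0 := by
    rw [sub_dotProduct, dotProduct_sub, dotProduct_sub, e1, dotProduct_comm (W *ᵥ _) z, e2]
    linarith
  have e4 : z - W *ᵥ (Wᵀ *ᵥ z) = 0 := by
    rw [← euclNorm_sq] at e3
    have : euclNorm (z - W *ᵥ (Wᵀ *ᵥ z)) = 0 :=
      pow_eq_zero_iff two_ne_zero |>.1 (le_antisymm e3 (sq_nonneg _))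
    exact (WithLp.toLp_injective 2) (norm_eq_zero.1 this)
  exact ⟨Wᵀ *ᵥ z, (sub_eq_zero.1 e4).symm⟩

/-- The number of singular values of `Zᵀ W` that equal `1` is at most `dim (col X ∩ col W)`. -/
theorem singularValue_lt_one (hZ : IsOrthonormalBasisOfCol X Z) (hW : Wᵀ * W = 1)
    (h : IsSVD (Zᵀ * W) U sv V) (hr : Module.finrank ℝ (overlap X W) ≤ r) : sv r < 1 := by
  by_contra hcon
  have h1 : 1 ≤ sv r := not_lt.1 hcon
  have hrp : r < p := by
    by_contra hp
    rw [h.eq_zero r (by omega)] at h1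
    norm_num at h1
  have horth := transpose_colsUpTo_mul_self (r := r + 1)
    (transpose_mul_self_mul_orthogonal hZ.orthonormal h.left_orth)
  have hinj : Function.Injective (colsUpTo (r + 1) (Z * U)).mulVec := by
    intro x y hxy
    have := congrArg (fun w => (colsUpTo (r + 1) (Z * U))ᵀ *ᵥ w) hxy
    simpa only [mulVec_mulVec, horth, one_mulVec] using this
  have hli := Matrix.mulVec_injective_iff.1 hinj
  -- If `sv r ≥ 1`, projecting onto `col W` does not shorten the first `r + 1` columns of `Z U`, so
  -- these lie in the overlap: `r + 1` independent vectors in dimension at most `r`.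
  have hmem : ∀ j, (colsUpTo (r + 1) (Z * U)).col j ∈ overlap X W := by
    intro j
    have hcol : (colsUpTo (r + 1) (Z * U)).col j = Z *ᵥ U.col j := by
      ext i
      simp [colsUpTo, mul_apply, mulVec, dotProduct]
    have hUj : Uᵀ *ᵥ U.col j = Pi.single (j : Fin p) 1 := by
      rw [← mulVec_single_one U, mulVec_mulVec, h.left_orth, one_mulVec]
    rw [hcol]
    refine ⟨?_, ?_⟩
    · rw [← hZ.span_eq]
      exact ⟨_, rfl⟩
    · refine mem_colSpace_of_dotProduct_le hW ?_
      have e1 : Z *ᵥ U.col j ⬝ᵥ Z *ᵥ U.col j = 1 := by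
        rw [dotProduct_mulVec_self, hZ.orthonormal, one_mulVec,
          ← dotProduct_transpose_mulVec_orthogonal h.left_orth, hUj]
        simp [Pi.single_apply]
      have e2 : Wᵀ *ᵥ Z *ᵥ U.col j = (Zᵀ * W)ᵀ *ᵥ U.col j := by
        rw [transpose_mul, transpose_transpose, mulVec_mulVec]
      rw [e1, e2, h.dotProduct_transpose_mulVec, hUj]
      simp only [Pi.single_apply, ite_pow, one_pow, ne_eq, OfNat.ofNat_ne_zero,
        not_false_eq_true, zero_pow, mul_ite, mul_one, mul_zero, Finset.sum_ite_eq',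
        Finset.mem_univ, if_true]
      exact one_le_pow₀ (h1.trans (h.antitone (Nat.lt_succ_iff.1 j.2)))
  have hli' : LinearIndependent ℝ fun j =>
      (⟨(colsUpTo (r + 1) (Z * U)).col j, hmem j⟩ : overlap X W) :=
    LinearIndependent.of_comp (overlap X W).subtype hli
  have hcard := hli'.fintype_card_le_finrank
  rw [card_lt_subtype (by omega)] at hcard
  omega

/-- If `σ_{r+1}² + τ < 1`, the singular value number `r + 1` of `Zᵀ Ŵ` is less than `1`. -/
theorem singularValue_hat_lt_one (hZ : Zᵀ * Z = 1) (h : IsSVD (Zᵀ * W) U sv V)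
    (hhat : IsSVD (Zᵀ * What) Uhat svhat Vhat) (hlt : sv r ^ 2 + tau Z W What < 1) :
    svhat r < 1 := by
  by_contra hcon
  have h1 : 1 ≤ svhat r := not_lt.1 hcon
  have hrp : r < p := by
    by_contra hp
    rw [hhat.eq_zero r (by omega)] at h1
    norm_num at h1
  -- Courant–Fischer by counting: `f` collects the `U`-coordinates below `r` and the `Û`-coordinates
  -- above `r`. Index `r` is left out, so these are `p - 1` conditions and some `x ≠ 0` satisfies
  -- all of them.
  let f : (Fin p → ℝ) →ₗ[ℝ] ({i : Fin p // i ≠ ⟨r, hrp⟩} → ℝ) :=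
    LinearMap.pi fun i => LinearMap.proj (i : Fin p) ∘ₗ
      (if ((i : Fin p) : ℕ) < r then Uᵀ else Uhatᵀ).mulVecLin
  have hker : LinearMap.ker f ≠ ⊥ := by
    refine LinearMap.ker_ne_bot_of_finrank_lt ?_
    simp only [Module.finrank_fintype_fun_eq_card, Fintype.card_fin, ne_eq,
      Fintype.card_subtype_compl, Fintype.card_unique]
    omega
  obtain ⟨x, hx, hx0⟩ := (Submodule.ne_bot_iff _).1 hker
  have hUx : ∀ i : Fin p, (i : ℕ) < r → (Uᵀ *ᵥ x) i = 0 := fun i hi => by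
    have := congrFun (LinearMap.mem_ker.1 hx) ⟨i, fun h => by simp [h] at hi⟩
    simpa [f, hi, mulVec_transpose] using this
  have hUhatx : ∀ i : Fin p, r < (i : ℕ) → (Uhatᵀ *ᵥ x) i = 0 := fun i hi => by
    have := congrFun (LinearMap.mem_ker.1 hx) ⟨i, fun h => by simp [h] at hi⟩
    simpa [f, hi.not_gt, mulVec_transpose] using this
  have hpos : 0 < x ⬝ᵥ x := by
    rw [← euclNorm_sq]
    refine pow_pos (norm_pos_iff.2 fun h => hx0 ?_) 2
    exact (WithLp.toLp_injective 2) h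
  have hle : (Zᵀ * W)ᵀ *ᵥ x ⬝ᵥ (Zᵀ * W)ᵀ *ᵥ x ≤ sv r ^ 2 * (x ⬝ᵥ x) := by
    rw [h.dotProduct_transpose_mulVec, ← dotProduct_transpose_mulVec_orthogonal h.left_orth,
      Finset.mul_sum]
    refine Finset.sum_le_sum fun i _ => ?_
    by_cases hi : (i : ℕ) < r
    · simp [hUx i hi]
    · exact mul_le_mul_of_nonneg_right
        (pow_le_pow_left₀ (h.nonneg _) (h.antitone (not_lt.1 hi)) 2) (sq_nonneg _)
  have hge : x ⬝ᵥ x ≤ (Zᵀ * What)ᵀ *ᵥ x ⬝ᵥ (Zᵀ * What)ᵀ *ᵥ x := by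
    rw [hhat.dotProduct_transpose_mulVec, ← dotProduct_transpose_mulVec_orthogonal hhat.left_orth]
    refine Finset.sum_le_sum fun i _ => ?_
    by_cases hi : r < (i : ℕ)
    · simp [hUhatx i hi]
    · exact le_mul_of_one_le_left (sq_nonneg _)
        (one_le_pow₀ (h1.trans (hhat.antitone (not_lt.1 hi))))
  -- The two quadratic forms, bounded by `σ_{r+1}² ‖x‖²` from above and by `‖x‖²` from below, differ
  -- by a form controlled by `τ`.
  have hsub : (Zᵀ * What)ᵀ *ᵥ x ⬝ᵥ (Zᵀ * What)ᵀ *ᵥ x - (Zᵀ * W)ᵀ *ᵥ x ⬝ᵥ (Zᵀ * W)ᵀ *ᵥ x =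
      (Z *ᵥ x) ⬝ᵥ ((What * Whatᵀ - W * Wᵀ) * Z) *ᵥ x := by
    simp only [transpose_mul, transpose_transpose, ← mulVec_mulVec, sub_mulVec, dotProduct_sub]
    rw [dotProduct_mulVec_self, dotProduct_mulVec_self, transpose_transpose, transpose_transpose,
      mulVec_mulVec, mulVec_mulVec]
    simp only [← mulVec_mulVec]
  have hnorm : euclNorm (Z *ᵥ x) = euclNorm x := by
    have : euclNorm (Z *ᵥ x) ^ 2 = euclNorm x ^ 2 := by
      rw [euclNorm_sq, euclNorm_sq, dotProduct_mulVec_self, hZ, one_mulVec]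
    exact (pow_left_inj₀ (euclNorm_nonneg _) (euclNorm_nonneg _) two_ne_zero).1 this
  have htau : (Z *ᵥ x) ⬝ᵥ ((What * Whatᵀ - W * Wᵀ) * Z) *ᵥ x ≤ tau Z W What * (x ⬝ᵥ x) := by
    refine (dotProduct_le_euclNorm_mul _ _).trans ?_
    rw [hnorm, ← euclNorm_sq, tau]
    nlinarith [euclNorm_mulVec_le ((What * Whatᵀ - W * Wᵀ) * Z) x, euclNorm_nonneg x]
  nlinarith

/-- If `τ` is at most half the cubed gap, the singular value number `r + 1` of `Zᵀ Ŵ` is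
less than `1`. -/
theorem singularValue_hat_lt_one_of_gap {s : ℕ} (hZ : IsOrthonormalBasisOfCol X Z)
    (hW : Wᵀ * W = 1) (h : IsSVD (Zᵀ * W) U sv V) (hhat : IsSVD (Zᵀ * What) Uhat svhat Vhat)
    (hr : Module.finrank ℝ (overlap X W) ≤ r) (hs : (Zᵀ * W).rank = r + s)
    (hgap : tau Z W What / gapCubed r s sv ≤ 1 / 2) : svhat r < 1 := by
  refine singularValue_hat_lt_one hZ.orthonormal h hhat ?_
  have h1 := singularValue_lt_one hZ hW h hr
  have h0 := h.nonneg r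
  unfold gapCubed at hgap
  split_ifs at hgap with hs0
  -- For `s = 0` the rank is `r`, so `σ_{r+1} = 0` and `τ ≤ 1/2` suffices.
  · rw [h.eq_zero_of_rank_le (m := r) (by omega)]
    norm_num at hgap ⊢
    linarith
  · have hpos : 0 < sv (r + s - 1) := h.pos_of_lt_rank (by omega)
    have hg : 0 < min ((1 - sv r) ^ 3) (sv (r + s - 1) ^ 3) :=
      lt_min (pow_pos (by linarith) 3) (pow_pos hpos 3)
    rw [div_le_iff₀ hg] at hgap
    -- The cube of a number in `[0, 1]` is at most that number, so `τ ≤ (1 - σ_{r+1}) / 2` and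
    -- `σ_{r+1}² + τ < 1`.
    have hle : min ((1 - sv r) ^ 3) (sv (r + s - 1) ^ 3) ≤ 1 - sv r :=
      (min_le_left _ _).trans (pow_le_of_le_one (by linarith) (by linarith) (by norm_num))
    nlinarith

end SingularValues

/-! ### Chi-squared laws of quadratic forms in Gaussian vectors -/

section GaussianForms

open Matrix Complex
open scoped RealInnerProductSpace

variable {E F : Type*} [NormedAddCommGroup E] [InnerProductSpace ℝ E] [FiniteDimensional ℝ E]
  [MeasurableSpace E] [BorelSpace E] [NormedAddCommGroup F] [InnerProductSpace ℝ F]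
  [FiniteDimensional ℝ F] [MeasurableSpace F] [BorelSpace F]

/-- A coisometry maps the standard Gaussian measure to the standard Gaussian measure. -/
theorem stdGaussian_map_of_coisometry (L : E →L[ℝ] F)
    (hL : L ∘L L.adjoint = ContinuousLinearMap.id ℝ F) :
    (stdGaussian E).map L = stdGaussian F := by
  apply Measure.ext_of_charFun
  ext t
  have h1 : charFun ((stdGaussian E).map L) t = charFun (stdGaussian E) (L.adjoint t) := by
    rw [charFun_apply, charFun_apply, integral_map (by fun_prop)
      (Measurable.aestronglyMeasurable (by fun_prop))]
    simp_rw [ContinuousLinearMap.adjoint_inner_right]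
  -- The standard Gaussian characteristic function depends only on the norm of its argument, and the
  -- adjoint of a coisometry is an isometry.
  have h2 : ‖L.adjoint t‖ ^ 2 = ‖t‖ ^ 2 := by
    rw [← real_inner_self_eq_norm_sq, ContinuousLinearMap.adjoint_inner_left,
      ← ContinuousLinearMap.comp_apply, hL, ContinuousLinearMap.id_apply,
      real_inner_self_eq_norm_sq]
  rw [h1, charFun_stdGaussian, charFun_stdGaussian, ← ofReal_pow, h2, ofReal_pow]

/-- Parseval: in an orthonormal basis the coordinates of a standard Gaussian vector are independent
standard normal variables. -/
theorem stdGaussian_map_norm_sq :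
    (stdGaussian E).map (fun x => ‖x‖ ^ 2) = chiSquared (Module.finrank ℝ E) := by
  rw [stdGaussian, Measure.map_map (by fun_prop) (by fun_prop), chiSquared]
  congr 1
  ext x
  have := (stdOrthonormalBasis ℝ E).sum_sq_norm_inner_right
    (∑ i, x i • stdOrthonormalBasis ℝ E i)
  rw [Function.comp_apply, ← this]
  refine Finset.sum_congr rfl fun i _ => ?_
  rw [(stdOrthonormalBasis ℝ E).orthonormal.inner_right_fintype, Real.norm_eq_abs, sq_abs]

theorem multivariateGaussian_zero_smul_one {ι : Type*} [Fintype ι] [DecidableEq ι] (σ : ℝ) :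
    multivariateGaussian 0 (σ ^ 2 • (1 : Matrix ι ι ℝ)) =
      (stdGaussian (EuclideanSpace ℝ ι)).map (σ • ·) := by
  apply Measure.ext_of_charFun
  ext t
  rw [charFun_multivariateGaussian (PosSemidef.one.smul (sq_nonneg σ)), charFun_map_smul,
    charFun_stdGaussian]
  have h1 : t.ofLp ⬝ᵥ (σ ^ 2 • (1 : Matrix ι ι ℝ)) *ᵥ t.ofLp = ‖σ • t‖ ^ 2 := by
    rw [smul_mulVec, one_mulVec, dotProduct_smul, norm_smul, mul_pow, Real.norm_eq_abs, sq_abs,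
      EuclideanSpace.real_norm_sq_eq, smul_eq_mul, dotProduct]
    simp only [sq]
  rw [h1, inner_zero_right]
  congr 1
  push_cast
  ring

/-- The squared norm of a coisometric image of a centered Gaussian vector with covariance `σ² I`
has, up to the factor `σ²`, a chi-squared distribution. -/
theorem map_norm_sq_coisometry {ι : Type*} [Fintype ι] [DecidableEq ι] {σ : ℝ} (hσ : 0 < σ)
    (L : EuclideanSpace ℝ ι →L[ℝ] F) (hL : L ∘L L.adjoint = ContinuousLinearMap.id ℝ F) :
    (multivariateGaussian 0 (σ ^ 2 • (1 : Matrix ι ι ℝ))).map (fun e => ‖L e‖ ^ 2 / σ ^ 2) =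
      chiSquared (Module.finrank ℝ F) := by
  rw [multivariateGaussian_zero_smul_one, Measure.map_map (by fun_prop) (by fun_prop),
    ← stdGaussian_map_norm_sq, ← stdGaussian_map_of_coisometry L hL,
    Measure.map_map (by fun_prop) (by fun_prop)]
  congr 1
  ext e
  simp only [Function.comp_apply, map_smul, norm_smul, mul_pow, Real.norm_eq_abs, sq_abs]
  field_simp

theorem map_euclNorm_sq_of_mul_transpose {ι κ : Type*} [Fintype ι] [DecidableEq ι] [Fintype κ]
    [DecidableEq κ] {σ : ℝ} (hσ : 0 < σ) {Q : Matrix κ ι ℝ} (hQ : Q * Qᵀ = 1) :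
    (multivariateGaussian 0 (σ ^ 2 • (1 : Matrix ι ι ℝ))).map
      (fun e => euclNorm (Q *ᵥ e.ofLp) ^ 2 / σ ^ 2) = chiSquared (Fintype.card κ) := by
  have h := map_norm_sq_coisometry hσ (Q.toEuclideanLin.toContinuousLinearMap) (by
    ext1 x
    rw [← LinearMap.adjoint_toContinuousLinearMap, ← Matrix.toEuclideanLin_conjTranspose_eq_adjoint,
      conjTranspose_eq_transpose_of_trivial]
    apply WithLp.ofLp_injective
    simp [Matrix.toLpLin_apply, mulVec_mulVec, hQ])
  rw [finrank_euclideanSpace] at h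
  exact h

/-- The squared norm of the image of a centered Gaussian vector with covariance `σ² I` under an
orthogonal projection of rank `d` has, up to the factor `σ²`, the law `χ²_d`. -/
theorem map_euclNorm_sq_of_projection {ι : Type*} [Fintype ι] [DecidableEq ι] {σ : ℝ} (hσ : 0 < σ)
    {S : Matrix ι ι ℝ} (hsymm : Sᵀ = S) (hidem : IsIdempotentElem S) {d : ℕ} (hd : S.trace = d) :
    (multivariateGaussian 0 (σ ^ 2 • (1 : Matrix ι ι ℝ))).map
      (fun e => euclNorm (S *ᵥ e.ofLp) ^ 2 / σ ^ 2) = chiSquared d := by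
  set T := toEuclideanCLM (n := ι) (𝕜 := ℝ) S with hT
  have hTp : IsStarProjection T := by
    refine ⟨?_, ?_⟩
    · rw [IsIdempotentElem, hT, ← map_mul, hidem]
    · rw [IsSelfAdjoint, hT, ← map_star, star_eq_conjTranspose,
        conjTranspose_eq_transpose_of_trivial, hsymm]
  obtain ⟨_, hTeq⟩ := isStarProjection_iff_eq_starProjection_range.1 hTp
  have htr : (d : ℝ) = Module.finrank ℝ T.range := by
    have h1 := (LinearMap.IsIdempotentElem.isProj_range T.toLinearMap
      (by rw [IsIdempotentElem]; ext1 x; exact DFunLike.congr_fun hTp.isIdempotentElem x)).trace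
    rw [← hd, ← h1, hT, coe_toEuclideanCLM_eq_toEuclideanLin,
      toEuclideanLin_eq_toLin_orthonormal, trace_toLin_eq]
  -- Viewed as a map onto its range, an orthogonal projection is a coisometry; the dimension of the
  -- range is the trace.
  have h := map_norm_sq_coisometry hσ (T.range.orthogonalProjectionOnto) (by
    rw [Submodule.adjoint_orthogonalProjectionOnto]
    ext1 x
    simp)
  have hd' : d = Module.finrank ℝ T.range := by exact_mod_cast htr
  rw [hd', ← h]
  congr 1
  ext e
  have : ‖T.range.orthogonalProjectionOnto e‖ = euclNorm (S *ᵥ e.ofLp) := by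
    have h1 : (T.range.orthogonalProjectionOnto e : EuclideanSpace ℝ ι) = T e := by
      conv_rhs => rw [hTeq]
      rfl
    rw [← Submodule.norm_coe, h1]
    rfl
  rw [this]

end GaussianForms

/-! ### Concentration of the chi-squared distribution -/

section Chebyshev

theorem memLp_sq_gaussianReal : MemLp (fun x : ℝ => x ^ 2) 2 (gaussianReal 0 1) := by
  rw [memLp_two_iff_integrable_sq (by fun_prop)]
  refine ((memLp_id_gaussianReal (μ := 0) (v := 1) 4).integrable_norm_pow (p := 4)
    (by norm_num)).congr (ae_of_all _ fun x => ?_)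
  simp only [id_eq, Real.norm_eq_abs]
  rw [← pow_mul, Even.pow_abs (by decide)]

theorem integral_sq_gaussianReal : ∫ x : ℝ, x ^ 2 ∂gaussianReal 0 1 = 1 := by
  have h := variance_id_gaussianReal (μ := 0) (v := 1)
  rw [variance_of_integral_eq_zero aemeasurable_id (by simp)] at h
  simpa using h

/-- Chebyshev's inequality for the mean of `d` independent squared standard normal variables. -/
theorem chiSquared_div_concentration {d : ℕ} (hd : 0 < d) {δ : ℝ} (hδ : 0 < δ) :
    chiSquared d {x | δ ≤ |x / d - 1|} ≤
      ENNReal.ofReal (Var[fun x : ℝ => x ^ 2; gaussianReal 0 1] / δ ^ 2 / d) := by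
  have hd' : (0 : ℝ) < d := by exact_mod_cast hd
  set ν : Measure (Fin d → ℝ) := Measure.pi fun _ => gaussianReal 0 1
  have hmem : ∀ i : Fin d, MemLp (fun x : Fin d → ℝ => x i ^ 2) 2 ν := fun i =>
    memLp_sq_gaussianReal.comp_measurePreserving
      (measurePreserving_eval (fun _ : Fin d => gaussianReal 0 1) i)
  have hsum : MemLp (fun x : Fin d → ℝ => ∑ i, x i ^ 2) 2 ν := memLp_finsetSum _ fun i _ => hmem i
  have hint : ∫ x, ∑ i, x i ^ 2 ∂ν = d := by
    rw [integral_finsetSum _ fun i _ => (hmem i).integrable one_le_two]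
    have : ∀ i : Fin d, ∫ x, x i ^ 2 ∂ν = 1 := fun i => by
      rw [← integral_sq_gaussianReal]
      exact integral_comp_eval (μ := fun _ : Fin d => gaussianReal 0 1) (i := i)
        (f := fun x : ℝ => x ^ 2) (by fun_prop)
    simp [this]
  have hvar : Var[fun x : Fin d → ℝ => ∑ i, x i ^ 2; ν] =
      d * Var[fun x : ℝ => x ^ 2; gaussianReal 0 1] := by
    have := variance_sum_pi (μ := fun _ : Fin d => gaussianReal 0 1)
      (X := fun _ => fun x : ℝ => x ^ 2) fun _ => memLp_sq_gaussianReal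
    simp only [Finset.sum_const, Finset.card_univ, Fintype.card_fin, nsmul_eq_mul] at this
    rw [← this]
    congr 1
    ext x
    simp
  have hcheb := meas_ge_le_variance_div_sq hsum (mul_pos hd' hδ)
  rw [hint, hvar] at hcheb
  rw [chiSquared, Measure.map_apply (by fun_prop)
    (measurableSet_le measurable_const (by fun_prop))]
  refine (le_of_eq ?_).trans (hcheb.trans (le_of_eq ?_))
  · congr 1
    ext x
    have : ((∑ i, x i ^ 2) / d - 1 : ℝ) = (∑ i, x i ^ 2 - d) / d := by field_simp
    simp only [Set.mem_preimage, Set.mem_ofPred_eq]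
    rw [this, abs_div, abs_of_pos hd', le_div_iff₀ hd', mul_comm]
  · congr 1
    field_simp

end Chebyshev

/-! ### Slutsky's theorem for a sequence of probability spaces -/

section Slutsky

variable {Ω : ℕ → Type*} [∀ n, MeasurableSpace (Ω n)] {μ : ∀ n, Measure (Ω n)}
  [∀ n, IsProbabilityMeasure (μ n)] {Ω' : Type*} [MeasurableSpace Ω'] {μ' : Measure Ω'}
  [IsProbabilityMeasure μ'] {Z : Ω' → ℝ}

/-- Convergence in distribution sees only the laws for large `n`; this permits changing probability
spaces and ignoring finitely many `n`. -/
theorem tendstoInDistribution_congr_map {Ω'' : ℕ → Type*} [∀ n, MeasurableSpace (Ω'' n)]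
    {ν : ∀ n, Measure (Ω'' n)} [∀ n, IsProbabilityMeasure (ν n)] {X : ∀ n, Ω n → ℝ}
    {Y : ∀ n, Ω'' n → ℝ} (hX : TendstoInDistribution X atTop Z μ μ')
    (hY : ∀ n, AEMeasurable (Y n) (ν n)) (h : ∀ᶠ n in atTop, (μ n).map (X n) = (ν n).map (Y n)) :
    TendstoInDistribution Y atTop Z ν μ' where
  forall_aemeasurable := hY
  aemeasurable_limit := hX.aemeasurable_limit
  tendsto := hX.tendsto.congr' (h.mono fun _ hn => Subtype.ext hn)

/-- **Slutsky's theorem** for a product whose second factor converges to `1` in probability;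
the probability spaces may vary. -/
theorem tendstoInDistribution_mul_of_tendsto_one {X Y : ∀ n, Ω n → ℝ}
    (hX : TendstoInDistribution X atTop Z μ μ') (hYm : ∀ n, AEMeasurable (Y n) (μ n))
    (hY : ∀ δ > 0, Tendsto (fun n => μ n {w | δ ≤ |Y n w - 1|}) atTop (nhds 0)) :
    TendstoInDistribution (fun n w => X n w * Y n w) atTop Z μ μ' := by
  -- The product of all `Ω n` carries copies of all the variables with unchanged laws, which brings
  -- the sequence onto one space.
  have hmp := fun n => measurePreserving_eval_infinitePi μ n
  have hXm : ∀ n, AEMeasurable (fun w : ∀ n, Ω n => X n (w n)) (Measure.infinitePi μ) := fun n =>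
    (hX.forall_aemeasurable n).comp_quasiMeasurePreserving (hmp n).quasiMeasurePreserving
  have hYm' : ∀ n, AEMeasurable (fun w : ∀ n, Ω n => Y n (w n)) (Measure.infinitePi μ) := fun n =>
    (hYm n).comp_quasiMeasurePreserving (hmp n).quasiMeasurePreserving
  have hmap : ∀ (n : ℕ) (f : Ω n → ℝ), AEMeasurable f (μ n) →
      (Measure.infinitePi μ).map (fun w => f (w n)) = (μ n).map f := fun n f hf => by
    rw [← (hmp n).map_eq] at hf
    conv_rhs => rw [← (hmp n).map_eq, AEMeasurable.map_map_of_aemeasurable hf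
      (hmp n).measurable.aemeasurable]
    rfl
  have hX' : TendstoInDistribution (fun n (w : ∀ n, Ω n) => X n (w n)) atTop Z
      (fun _ => Measure.infinitePi μ) μ' :=
    tendstoInDistribution_congr_map hX hXm
      (Eventually.of_forall fun n => (hmap n _ (hX.forall_aemeasurable n)).symm)
  have hY' : TendstoInMeasure (Measure.infinitePi μ) (fun n (w : ∀ n, Ω n) => Y n (w n)) atTop
      fun _ => (1 : ℝ) := by
    rw [tendstoInMeasure_iff_norm]
    refine fun δ hδ => (hY δ hδ).congr fun n => ?_
    have hs : NullMeasurableSet {w | δ ≤ |Y n w - 1|} (μ n) :=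
      nullMeasurableSet_le aemeasurable_const (((hYm n).sub_const 1).norm)
    exact ((hmp n).measure_preimage hs).symm
  have h := hX'.continuous_comp_prodMk_of_tendstoInMeasure_const (g := fun x => x.1 * x.2)
    (by fun_prop) hY' hYm'
  simp only [mul_one] at h
  exact tendstoInDistribution_congr_map h
    (fun n => (hX.forall_aemeasurable n).mul (hYm n))
    (Eventually.of_forall fun n => hmap n _ ((hX.forall_aemeasurable n).mul (hYm n)))

/-- Since `y > 1/2`, inversion at most doubles the distance to `1`. -/
theorem abs_inv_sub_one_lt {y δ : ℝ} (hδ : 0 < δ) (hy : |y - 1| < min (1 / 2) (δ / 2)) :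
    |y⁻¹ - 1| < δ := by
  have h1 := hy.trans_le (min_le_left _ _)
  have h2 := hy.trans_le (min_le_right _ _)
  have hy0 : 1 / 2 < y := by linarith [(abs_lt.1 h1).1]
  have : y⁻¹ - 1 = (1 - y) / y := by field_simp
  rw [this, abs_div, abs_of_pos (by linarith : 0 < y), div_lt_iff₀ (by linarith), abs_sub_comm]
  nlinarith

end Slutsky

/-! ### The test statistic -/

section Statistic

open Matrix

variable {n p K r : ℕ} {X Z : Matrix (Fin n) (Fin p) ℝ} {W : Matrix (Fin n) (Fin K) ℝ}
  {U : Matrix (Fin p) (Fin p) ℝ} {V : Matrix (Fin K) (Fin K) ℝ} {sv : ℕ → ℝ}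

/-- The matrix `A` of `γ̂`, normalized to `(A Aᵀ)^{-1/2} A`. -/
noncomputable def normalizedGammaMatrix (r : ℕ) (Z : Matrix (Fin n) (Fin p) ℝ)
    (W : Matrix (Fin n) (Fin K) ℝ) (U : Matrix (Fin p) (Fin p) ℝ) (V : Matrix (Fin K) (Fin K) ℝ) :
    Matrix {j : Fin K // r ≤ (j : ℕ)} (Fin n) ℝ :=
  invSqrt (gammaMatrix r Z W U V * (gammaMatrix r Z W U V)ᵀ) * gammaMatrix r Z W U V

theorem euclNorm_smul {ι : Type*} [Fintype ι] (c : ℝ) (v : ι → ℝ) :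
    euclNorm (c • v) = |c| * euclNorm v := by
  rw [euclNorm, WithLp.toLp_smul, norm_smul, Real.norm_eq_abs, euclNorm]

theorem continuous_euclNorm {ι : Type*} [Fintype ι] : Continuous (euclNorm : (ι → ℝ) → ℝ) :=
  (PiLp.continuous_toLp 2 _).norm

theorem continuous_euclNorm_mulVec {m k : Type*} [Fintype m] [Fintype k] (A : Matrix m k ℝ) :
    Continuous fun e : EuclideanSpace ℝ k => euclNorm (A *ᵥ e.ofLp) :=
  continuous_euclNorm.comp (continuous_const.matrix_mulVec (PiLp.continuous_ofLp 2 _))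

/-- Separates the random scale `σ̂²` from a deterministic matrix; this form also makes the statistic
visibly measurable in `Y`. -/
theorem euclNorm_gammaHatZero_sq (Y : Fin n → ℝ) :
    euclNorm (gammaHatZero r Z W U V Y) ^ 2 =
      (Real.sqrt (sigmaHatSq r Z W U V Y))⁻¹ ^ 2 *
        euclNorm (normalizedGammaMatrix r Z W U V *ᵥ Y) ^ 2 := by
  have h1 : covGammaHat r Z W U V Y = sigmaHatSq r Z W U V Y •
      (gammaMatrix r Z W U V * (gammaMatrix r Z W U V)ᵀ) := by
    rw [covGammaHat, gammaMatrix, transpose_mul, transpose_transpose]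
    simp only [Matrix.mul_assoc]
  have h2 : (gammaMatrix r Z W U V * (gammaMatrix r Z W U V)ᵀ).PosSemidef := by
    rw [← conjTranspose_eq_transpose_of_trivial]
    exact posSemidef_self_mul_conjTranspose _
  have h3 : gammaHat r Z W U V Y = gammaMatrix r Z W U V *ᵥ Y := mulVec_mulVec _ _ _
  rw [gammaHatZero, h1, invSqrt_smul _ h2, h3, smul_mulVec, mulVec_mulVec, euclNorm_smul, mul_pow,
    sq_abs, normalizedGammaMatrix]

theorem normalizedGammaMatrix_mul_transpose (hZ : Zᵀ * Z = 1) (hW : Wᵀ * W = 1)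
    (h : IsSVD (Zᵀ * W) U sv V) (hlt : sv r < 1) :
    normalizedGammaMatrix r Z W U V * (normalizedGammaMatrix r Z W U V)ᵀ = 1 := by
  rw [normalizedGammaMatrix, transpose_mul, transpose_invSqrt, Matrix.mul_assoc,
    ← Matrix.mul_assoc _ _ (invSqrt _), ← Matrix.mul_assoc,
    invSqrt_mul_self_mul_invSqrt (posDef_gammaMatrix_mul_transpose hZ hW h hlt)]

theorem normalizedGammaMatrix_mulVec_add (hZ : Zᵀ * Z = 1) (hW : Wᵀ * W = 1)
    (h : IsSVD (Zᵀ * W) U sv V) (hlt : sv r < 1) {m : Fin n → ℝ} (hm : m ∈ colSpace Z)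
    (e : Fin n → ℝ) :
    normalizedGammaMatrix r Z W U V *ᵥ (m + e) = normalizedGammaMatrix r Z W U V *ᵥ e := by
  obtain ⟨u, rfl⟩ := hm
  have h0 : normalizedGammaMatrix r Z W U V * Z = 0 := by
    have h1 : gammaMatrix r Z W U V * Z = 0 := by
      rw [gammaMatrix, Matrix.mul_assoc, PNhat_mul_Z hZ hW h hlt, Matrix.mul_zero]
    rw [normalizedGammaMatrix, Matrix.mul_assoc, h1, Matrix.mul_zero]
  rw [mulVec_add, mulVecLin_apply, mulVec_mulVec, h0, zero_mulVec, zero_add]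

theorem residual_add (hZ : Zᵀ * Z = 1) (hW : Wᵀ * W = 1) (h : IsSVD (Zᵀ * W) U sv V)
    (hlt : sv r < 1) {m : Fin n → ℝ} (hm : m ∈ colSpace Z) (e : Fin n → ℝ) :
    m + e - Hhat r Z W U V *ᵥ (m + e) = (1 - Hhat r Z W U V) *ᵥ e := by
  obtain ⟨u, rfl⟩ := hm
  rw [mulVec_add, mulVecLin_apply, mulVec_mulVec, Hhat_mul_Z hZ hW h hlt, sub_mulVec, one_mulVec]
  abel

/-- If the mean lies in the column space of the design, `‖γ̂₀‖²` is the quotient of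
`‖(A Aᵀ)^{-1/2} A ε‖² / σ²` and the mean residual sum of squares divided by `σ²`. -/
theorem euclNorm_gammaHatZero_sq_add (hZ : Zᵀ * Z = 1) (hW : Wᵀ * W = 1)
    (h : IsSVD (Zᵀ * W) U sv V) (hlt : sv r < 1) {m : Fin n → ℝ} (hm : m ∈ colSpace Z)
    (e : Fin n → ℝ) {σ : ℝ} (hσ : 0 < σ) {d : ℕ} (hd : (n : ℝ) - p - K + r = d) :
    euclNorm (gammaHatZero r Z W U V (m + e)) ^ 2 =
      euclNorm (normalizedGammaMatrix r Z W U V *ᵥ e) ^ 2 / σ ^ 2 *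
        (euclNorm ((1 - Hhat r Z W U V) *ᵥ e) ^ 2 / σ ^ 2 / d)⁻¹ := by
  have hσ' : σ ^ 2 ≠ 0 := (pow_pos hσ 2).ne'
  -- As `d` is a natural number, `σ̂² ≥ 0`. A zero residual or `d = 0` is covered by the convention
  -- `0⁻¹ = 0`.
  rw [euclNorm_gammaHatZero_sq, normalizedGammaMatrix_mulVec_add hZ hW h hlt hm, sigmaHatSq,
    residual_add hZ hW h hlt hm, hd, inv_pow, Real.sq_sqrt (by positivity)]
  simp only [div_eq_mul_inv, mul_inv, inv_inv]
  field_simp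

theorem measurable_euclNorm_gammaHatZero_sq :
    Measurable fun Y : Fin n → ℝ => euclNorm (gammaHatZero r Z W U V Y) ^ 2 := by
  simp only [euclNorm_gammaHatZero_sq]
  have h1 : Measurable fun Y : Fin n → ℝ => sigmaHatSq r Z W U V Y :=
    (((continuous_euclNorm.comp (continuous_id.sub
      (continuous_const.matrix_mulVec continuous_id))).pow 2).div_const _).measurable
  have h2 : Measurable fun Y : Fin n → ℝ => euclNorm (normalizedGammaMatrix r Z W U V *ᵥ Y) ^ 2 :=
    ((continuous_euclNorm.comp (continuous_const.matrix_mulVec continuous_id)).pow 2).measurable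
  exact ((h1.sqrt.inv).pow_const 2).mul h2

theorem trace_one_sub_Hhat (hZ : Zᵀ * Z = 1) (hW : Wᵀ * W = 1) (h : IsSVD (Zᵀ * W) U sv V)
    (hlt : sv r < 1) (hrp : r ≤ p) (hrK : r ≤ K) :
    (1 - Hhat r Z W U V).trace = (n : ℝ) - p - K + r := by
  rw [trace_sub, trace_one, trace_Hhat hZ hW h hlt hrp hrK, Fintype.card_fin]
  ring

theorem finrank_colSpace_le {k : ℕ} (A : Matrix (Fin n) (Fin k) ℝ) :
    Module.finrank ℝ (colSpace A) ≤ k := by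
  have := LinearMap.finrank_range_le A.mulVecLin
  rwa [Module.finrank_fintype_fun_eq_card, Fintype.card_fin] at this

theorem finrank_overlap_le_left : Module.finrank ℝ (overlap X W) ≤ p :=
  (Submodule.finrank_mono inf_le_left).trans (finrank_colSpace_le X)

theorem finrank_overlap_le_right : Module.finrank ℝ (overlap X W) ≤ K :=
  (Submodule.finrank_mono inf_le_right).trans (finrank_colSpace_le W)

theorem meanVec_mem_colSpace (hZ : IsOrthonormalBasisOfCol X Z) (β θ : Fin p → ℝ) :
    meanVec X β θ 0 ∈ colSpace Z := by
  rw [hZ.span_eq, meanVec, add_zero]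
  exact Submodule.add_mem _ ⟨β, rfl⟩ ⟨θ, rfl⟩

end Statistic

/-! ### Consequences of the asymptotic assumptions. -/

section Asymptotics

theorem SmallPerturbation.eventually_le_half {K r : ℕ} {s p : ℕ → ℕ}
    {Z : ∀ n, Matrix (Fin n) (Fin (p n)) ℝ} {W What : ∀ n, Matrix (Fin n) (Fin K) ℝ}
    {sv : ℕ → ℕ → ℝ} (h : SmallPerturbation r s p Z W What sv) :
    ∀ᶠ n in atTop, tau (Z n) (W n) (What n) / gapCubed r (s n) (sv n) ≤ 1 / 2 := by
  filter_upwards [h.def (one_half_pos (α := ℝ))] with n hn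
  refine (le_abs_self _).trans (hn.trans ?_)
  refine mul_le_of_le_one_right one_half_pos.le ?_
  rw [Real.norm_of_nonneg (by positivity), ← Nat.cast_mul]
  rcases Nat.eq_zero_or_pos (n * p n) with h0 | h0
  -- When `n p = 0`, the rate `1 / √(n p)` is `0` by convention, so it is still at most `1`.
  · simp [h0]
  · rw [div_le_one (Real.sqrt_pos.2 (by exact_mod_cast h0)), Real.one_le_sqrt]
    exact_mod_cast h0

theorem tendsto_residual_degrees (K r : ℕ) {p : ℕ → ℕ}
    (hp : (fun n => (p n : ℝ)) =o[atTop] fun n : ℕ => (n : ℝ)) :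
    Tendsto (fun n : ℕ => (n : ℝ) - p n - K + r) atTop atTop := by
  have h1 : Tendsto (fun n : ℕ => (n : ℝ) / 2 - K + r) atTop atTop :=
    tendsto_atTop_add_const_right _ _ (tendsto_atTop_add_const_right _ (-(K : ℝ))
      (tendsto_natCast_atTop_atTop.atTop_div_const two_pos))
  refine tendsto_atTop_mono' _ ?_ h1
  -- Eventually `p ≤ n / 2`, so at least `n / 2 - K + r` degrees of freedom remain.
  filter_upwards [hp.def (one_half_pos (α := ℝ))] with n hn
  rw [Real.norm_of_nonneg (Nat.cast_nonneg _), Real.norm_of_nonneg (Nat.cast_nonneg _)] at hn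
  linarith

theorem tendsto_chiSquared_div_concentration {d : ℕ → ℕ}
    (hd : Tendsto (fun n => (d n : ℝ)) atTop atTop) {δ : ℝ} (hδ : 0 < δ) :
    Tendsto (fun n => chiSquared (d n) {x | δ ≤ |x / d n - 1|}) atTop (nhds 0) := by
  have h1 : Tendsto (fun n => ENNReal.ofReal
      (Var[fun x : ℝ => x ^ 2; gaussianReal 0 1] / δ ^ 2 / d n)) atTop (nhds 0) := by
    rw [← ENNReal.ofReal_zero]
    exact ENNReal.tendsto_ofReal (tendsto_const_nhds.div_atTop hd)
  refine tendsto_of_tendsto_of_tendsto_of_le_of_le' tendsto_const_nhds h1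
    (Eventually.of_forall fun _ => zero_le) ?_
  filter_upwards [hd.eventually_gt_atTop 0] with n hn
  exact chiSquared_div_concentration (by exact_mod_cast hn) hδ

end Asymptotics

end NetReg

/-! ### The limit law of the test statistic. -/

theorem mainTheorem4
    -- fixed number `K` of leading eigenvectors, fixed dimension `r` of `col(X) ∩ S_K(P)`,
    -- noise level `σ`
    (K r : ℕ) (σ : ℝ) (hσ : 0 < σ)
    -- number of covariates
    (p : ℕ → ℕ) (hp : (fun n => (p n : ℝ)) =o[atTop] fun n : ℕ => (n : ℝ))
    -- design, relational matrix and its approximation, parameters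
    (X : ∀ n, Matrix (Fin n) (Fin (p n)) ℝ)
    (P Phat : ∀ n, Matrix (Fin n) (Fin n) ℝ)
    (β θ : ∀ n, Fin (p n) → ℝ) (α : ∀ n, Fin n → ℝ)
    -- orthonormal basis of `col(X)`, leading eigenvectors of `P` and of `Phat`
    (Z : ∀ n, Matrix (Fin n) (Fin (p n)) ℝ)
    (W What : ∀ n, Matrix (Fin n) (Fin K) ℝ)
    (hZ : ∀ᶠ n in atTop, NetReg.IsOrthonormalBasisOfCol (X n) (Z n))
    (hW : ∀ᶠ n in atTop, NetReg.IsLeadingEigenvectors (P n) (W n))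
    (hWhat : ∀ᶠ n in atTop, NetReg.IsLeadingEigenvectors (Phat n) (What n))
    -- singular value decompositions of `Zᵀ W` and `Zᵀ What`
    (U Uhat : ∀ n, Matrix (Fin (p n)) (Fin (p n)) ℝ)
    (V Vhat : ∀ _ : ℕ, Matrix (Fin K) (Fin K) ℝ)
    (sv svhat : ℕ → ℕ → ℝ)
    (hSVD : ∀ᶠ n in atTop, NetReg.IsSVD ((Z n)ᵀ * W n) (U n) (sv n) (V n))
    (hSVDhat : ∀ᶠ n in atTop, NetReg.IsSVD ((Z n)ᵀ * What n) (Uhat n) (svhat n) (Vhat n))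
    -- `r = dim (col(X) ∩ S_K(P))`, and `Zᵀ W` has `r + s` nonzero singular values
    (s : ℕ → ℕ)
    (hr : ∀ᶠ n in atTop, Module.finrank ℝ (NetReg.overlap (X n) (W n)) = r)
    (hs : ∀ᶠ n in atTop, ((Z n)ᵀ * W n).rank = r + s n)
    -- the model and the two assumptions
    (hmodel : ∀ᶠ n in atTop, NetReg.IsModel (X n) (W n) (β n) (θ n) (α n))
    (hscale : NetReg.StandardizedScale p X β θ α)
    (hpert : NetReg.SmallPerturbation r s p Z W What sv)
    -- Gaussian noise
    {Ω : ℕ → Type*} [∀ n, MeasurableSpace (Ω n)]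
    (μ : ∀ n, Measure (Ω n)) [∀ n, IsProbabilityMeasure (μ n)]
    (ε : ∀ n, Ω n → EuclideanSpace ℝ (Fin n))
    (hε : ∀ n, HasLaw (ε n) (multivariateGaussian 0 (σ ^ 2 • (1 : Matrix (Fin n) (Fin n) ℝ))) (μ n))
    -- the response `Y = X β + X θ + α + ε`
    (Y : ∀ n, Ω n → Fin n → ℝ)
    (hY : ∀ n w, Y n w = NetReg.meanVec (X n) (β n) (θ n) (α n) + (ε n w).ofLp)
    -- the null hypothesis
    (H₀ : ∀ n, α n = 0) :
    TendstoInDistribution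
      (fun n w => NetReg.euclNorm
        (NetReg.gammaHatZero r (Z n) (What n) (Uhat n) (Vhat n) (Y n w)) ^ 2)
      atTop (id : ℝ → ℝ) μ (NetReg.chiSquared (K - r)) := by
  -- The residual degrees of freedom with truncated subtraction; this agrees with the real
  -- expression for large `n` (`hdn`).
  set d : ℕ → ℕ := fun n => n + r - p n - K with hd
  have hε' : ∀ n (f : EuclideanSpace ℝ (Fin n) → ℝ), Measurable f → (μ n).map (fun w => f (ε n w)) =
      (multivariateGaussian 0 (σ ^ 2 • (1 : Matrix (Fin n) (Fin n) ℝ))).map f := fun n f hf => by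
    rw [← (hε n).map_eq, AEMeasurable.map_map_of_aemeasurable hf.aemeasurable (hε n).aemeasurable]
    rfl
  let Q := fun n => NetReg.normalizedGammaMatrix r (Z n) (What n) (Uhat n) (Vhat n)
  let H := fun n => NetReg.Hhat r (Z n) (What n) (Uhat n) (Vhat n)
  let f : ∀ n, EuclideanSpace ℝ (Fin n) → ℝ := fun n e =>
    NetReg.euclNorm (Q n *ᵥ e.ofLp) ^ 2 / σ ^ 2
  let g : ∀ n, EuclideanSpace ℝ (Fin n) → ℝ := fun n e =>
    NetReg.euclNorm ((1 - H n) *ᵥ e.ofLp) ^ 2 / σ ^ 2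
  have hf : ∀ n, Measurable (f n) := fun n =>
    (((NetReg.continuous_euclNorm_mulVec (Q n)).pow 2).div_const _).measurable
  have hg : ∀ n, Measurable (g n) := fun n =>
    (((NetReg.continuous_euclNorm_mulVec (1 - H n)).pow 2).div_const _).measurable
  have hlt : ∀ᶠ n in atTop, svhat n r < 1 := by
    filter_upwards [hZ, hW, hSVD, hSVDhat, hr, hs, hpert.eventually_le_half]
      with n hZ hW hSVD hSVDhat hr hs hgap
    exact NetReg.singularValue_hat_lt_one_of_gap hZ hW.orthonormal hSVD hSVDhat hr.le hs hgap
  have hrK : ∀ᶠ n in atTop, r ≤ p n ∧ r ≤ K := hr.mono fun n hn =>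
    ⟨hn ▸ NetReg.finrank_overlap_le_left, hn ▸ NetReg.finrank_overlap_le_right⟩
  have hdn : ∀ᶠ n : ℕ in atTop, (n : ℝ) - p n - K + r = d n := by
    filter_upwards [(NetReg.tendsto_residual_degrees K r hp).eventually_ge_atTop 0] with n hn
    have h1 : p n + K ≤ n + r := by
      have : ((p n + K : ℕ) : ℝ) ≤ ((n + r : ℕ) : ℝ) := by push_cast; linarith
      exact_mod_cast this
    have h2 : d n + (p n + K) = n + r := by simp only [hd]; omega
    have h3 : ((d n + (p n + K) : ℕ) : ℝ) = ((n + r : ℕ) : ℝ) := by rw [h2]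
    push_cast at h3
    linarith
  have hdtop : Tendsto (fun n => (d n : ℝ)) atTop atTop :=
    (NetReg.tendsto_residual_degrees K r hp).congr' hdn
  have hlawf : ∀ᶠ n in atTop, (μ n).map (fun w => f n (ε n w)) = NetReg.chiSquared (K - r) := by
    filter_upwards [hZ, hWhat, hSVDhat, hlt] with n hZ hWhat hSVDhat hlt
    rw [hε' n _ (hf n), NetReg.map_euclNorm_sq_of_mul_transpose hσ
      (NetReg.normalizedGammaMatrix_mul_transpose hZ.orthonormal hWhat.orthonormal hSVDhat hlt),
      NetReg.card_ge_subtype]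
  have hlawg : ∀ᶠ n in atTop, (μ n).map (fun w => g n (ε n w)) = NetReg.chiSquared (d n) := by
    filter_upwards [hZ, hWhat, hSVDhat, hlt, hrK, hdn] with n hZ hWhat hSVDhat hlt hrK hdn
    rw [hε' n _ (hg n)]
    refine NetReg.map_euclNorm_sq_of_projection hσ ?_ ?_ ?_
    · rw [Matrix.transpose_sub, Matrix.transpose_one, NetReg.transpose_Hhat]
    · exact (NetReg.isIdempotentElem_Hhat hZ.orthonormal hWhat.orthonormal hSVDhat hlt).one_sub
    · rw [← hdn]
      exact NetReg.trace_one_sub_Hhat hZ.orthonormal hWhat.orthonormal hSVDhat hlt hrK.1 hrK.2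
  have hfm : ∀ n, AEMeasurable (fun w => f n (ε n w)) (μ n) := fun n =>
    (hf n).comp_aemeasurable (hε n).aemeasurable
  have hgm : ∀ n, AEMeasurable (fun w => g n (ε n w)) (μ n) := fun n =>
    (hg n).comp_aemeasurable (hε n).aemeasurable
  -- The numerator has the limit law itself for large `n`, so it converges like a constant sequence.
  have hX : TendstoInDistribution (fun n w => f n (ε n w)) atTop (id : ℝ → ℝ) μ
      (NetReg.chiSquared (K - r)) :=
    NetReg.tendstoInDistribution_congr_map
      (tendstoInDistribution_const (ι := ℕ) (l := atTop) (μ' := NetReg.chiSquared (K - r))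
        (Z := (id : ℝ → ℝ)) aemeasurable_id) hfm
      (hlawf.mono fun n hn => by rw [hn, Measure.map_id])
  have hprod := NetReg.tendstoInDistribution_mul_of_tendsto_one hX
    (Y := fun n w => (g n (ε n w) / d n)⁻¹) (fun n => ((hgm n).div_const _).inv) (by
      intro δ hδ
      have hδ' : 0 < min (1 / 2) (δ / 2) := lt_min one_half_pos (half_pos hδ)
      refine tendsto_of_tendsto_of_tendsto_of_le_of_le' tendsto_const_nhds
        (NetReg.tendsto_chiSquared_div_concentration hdtop hδ')
        (Eventually.of_forall fun _ => zero_le) ?_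
      filter_upwards [hlawg] with n hn
      rw [← hn, Measure.map_apply_of_aemeasurable (hgm n)
        (measurableSet_le measurable_const (by fun_prop))]
      refine measure_mono fun w hw => ?_
      by_contra hcon
      exact absurd (NetReg.abs_inv_sub_one_lt hδ (not_le.1 hcon)) (not_lt.2 hw))
  have hYm : ∀ n, AEMeasurable (Y n) (μ n) := fun n => by
    have h1 : Y n = fun w => NetReg.meanVec (X n) (β n) (θ n) (α n) + (ε n w).ofLp :=
      funext (hY n)
    rw [h1]
    exact aemeasurable_const.add
      ((PiLp.continuous_ofLp 2 _).measurable.comp_aemeasurable (hε n).aemeasurable)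
  refine NetReg.tendstoInDistribution_congr_map hprod
    (fun n => NetReg.measurable_euclNorm_gammaHatZero_sq.comp_aemeasurable (hYm n)) ?_
  -- For large `n` the statistic equals the product pointwise, not only in law.
  filter_upwards [hZ, hWhat, hSVDhat, hlt, hdn] with n hZ hWhat hSVDhat hlt hdn
  congr 1
  ext w
  rw [hY, H₀, NetReg.euclNorm_gammaHatZero_sq_add hZ.orthonormal hWhat.orthonormal hSVDhat hlt
    (NetReg.meanVec_mem_colSpace hZ _ _) _ hσ hdn]
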